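/- For $n\ge 2$ let $\mathbb R^n$ carry its standard Euclidean structure. A subspace of $\mathbb R^n$ is rational if it has a basis of vectors with rational coordinates; let $\mathfrak R_n(e)$ be the set of rational subspaces of dimension $e$. The height $H(B)$ of $B\in\mathfrak R_n(e)$ is the Euclidean norm of an integer vector with setwise coprime coordinates in the class of Plücker coordinates of $B$. For subspaces $A,B$ of dimensions $d,e$ and $1\le j\le\min(d,e)$ let $\psi_j(A,B)$ be the sine of the $j$-th canonical angle between $A$ and $B$: having chosen unit vectors $X_1,\dots,X_{j-1}\in A$ and $Y_1,\dots,Y_{j-1}\in B$, one sets $$\psi_j(A,B)=\min\ \sin\widehat{(X,Y)},$$ the minimum being over the nonzero $X\in A$ orthogonal to $X_1,\dots,X_{j-1}$ and the nonzero $Y\in B$ orthogonal to $Y_1,\dots,Y_{j-1}$, and one chooses unit vectors $X_j,Y_j$ attaining it (the values do not depend on the choices). Let $\mathfrak I_n(d,e)_j$ be the set of subspaces $A$ of dimension $d$ of $\mathbb R^n$ such that $\dim(A\cap B)<j$ for all $B\in\mathfrak R_n(e)$. For $A\in\mathfrak I_n(d,e)_j$ let $\mu_n(A|e)_j\in[0,+\infty]$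 be the supremum of all real $\beta>0$ such that $\psi_j(A,B)\le H(B)^{-\beta}$ for infinitely many $B\in\mathfrak R_n(e)$, and let $$\mathring\mu_n(d|e)_j=\inf_{A\in\mathfrak I_n(d,e)_j}\mu_n(A|e)_j .$$ Let $d\ge 1$ be an integer. For every integer $n\ge 2d$, $$\frac{2dn-d^2+d+2}{2d^2n-d^3+d^2}\ \le\ \mathring\mu_n(d|d)_d\ \le\ \frac{n}{d(n-d)},$$ and, for $d$ fixed, $$\lim_{n\to+\infty}\mathring\mu_n(d|d)_d=\frac1d .$$ -/

import Mathlib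

open Filter Topology
open scoped ENNReal

noncomputable section

namespace SubspaceApprox

/-- The Euclidean space `ℝⁿ`. -/
abbrev E (n : ℕ) : Type := EuclideanSpace ℝ (Fin n)

/-- The set of rational subspaces of dimension `e` of `ℝⁿ`: those that have a basis of `e` vectors
with rational coordinates. -/
def rationalSubspaces (n e : ℕ) : Set (Submodule ℝ (E n)) :=
  {B | ∃ b : Fin e → E n, (∀ i k, ∃ q : ℚ, b i k = (q : ℝ)) ∧
    LinearIndependent ℝ b ∧ Submodule.span ℝ (Set.range b) = B}

/-- The set of `(e, j)`-irrational subspaces of dimension `d` of `ℝⁿ`. -/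
def irrationalSubspaces (n d e j : ℕ) : Set (Submodule ℝ (E n)) :=
  {A | Module.finrank ℝ A = d ∧
    ∀ B ∈ rationalSubspaces n e, Module.finrank ℝ (A ⊓ B : Submodule ℝ (E n)) < j}

/-- The index set of Plücker coordinates: the `e`-element subsets of the `n` coordinates. -/
abbrev PluckerIndex (n e : ℕ) : Type := {I : Finset (Fin n) // I.card = e}

/-- The Plücker coordinates of a family of `e` vectors of `ℝⁿ`: the `e × e` minors of the
`n × e` matrix whose columns are the vectors. -/
def plucker {n e : ℕ} (b : Fin e → E n) (I : PluckerIndex n e) : ℝ :=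
  (Matrix.of fun i k : Fin e => b k (I.1.orderEmbOfFin I.2 i)).det

/-- `Ξ` is an integer vector with setwise coprime coordinates in the class (up to scalars) of the
Plücker coordinates of the `e`-dimensional subspace `B`. -/
def IsPrimitivePlucker {n e : ℕ} (B : Submodule ℝ (E n)) (Ξ : PluckerIndex n e → ℤ) : Prop :=
  Finset.univ.gcd Ξ = 1 ∧
    ∃ b : Fin e → E n, LinearIndependent ℝ b ∧ Submodule.span ℝ (Set.range b) = B ∧
      ∃ c : ℝ, ∀ I, (Ξ I : ℝ) = c * plucker b I

/-- The height of a rational subspace `B` of dimension `e`: the Euclidean norm of a primitive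
integer vector `Ξ` of Plücker coordinates of `B`. As `Ξ` is unique up to sign, the infimum is over
a set with one element. -/
def height {n : ℕ} (e : ℕ) (B : Submodule ℝ (E n)) : ℝ :=
  sInf {h | ∃ Ξ : PluckerIndex n e → ℤ, IsPrimitivePlucker B Ξ ∧
    h = Real.sqrt (∑ I, (Ξ I : ℝ) ^ 2)}

/-- The sine of the angle between two vectors. -/
def psiVec {n : ℕ} (X Y : E n) : ℝ := Real.sin (InnerProductGeometry.angle X Y)

/-- The vectors of `A` that are orthogonal to `X 1, …, X i`. -/
def orthPart {n : ℕ} (A : Submodule ℝ (E n)) (X : ℕ → E n) (i : ℕ) : Submodule ℝ (E n) :=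
  A ⊓ (Submodule.span ℝ (X '' Set.Icc 1 i))ᗮ

/-- `(X 1, Y 1), …, (X j, Y j)` are successive pairs of unit vectors that realise the canonical
angles between `A` and `B`: the pair of index `i + 1` minimises the sine of the angle among the
pairs of nonzero vectors of the orthogonal complements of `X 1, …, X i` in `A` and of
`Y 1, …, Y i` in `B`. -/
def IsPrincipalFamily {n : ℕ} (A B : Submodule ℝ (E n)) (j : ℕ) (X Y : ℕ → E n) : Prop :=
  ∀ i < j, X (i + 1) ∈ orthPart A X i ∧ Y (i + 1) ∈ orthPart B Y i ∧
    ‖X (i + 1)‖ = 1 ∧ ‖Y (i + 1)‖ = 1 ∧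
    ∀ X' ∈ orthPart A X i, ∀ Y' ∈ orthPart B Y i, X' ≠ 0 → Y' ≠ 0 →
      psiVec (X (i + 1)) (Y (i + 1)) ≤ psiVec X' Y'

/-- The proximity `ψ_j(A, B)`, `1 ≤ j ≤ min (dim A) (dim B)`: the sine of the `j`-th canonical
angle between `A` and `B`. It does not depend on the successive choices of minimising vectors, so
the infimum is over a set with one element. -/
def psi {n : ℕ} (j : ℕ) (A B : Submodule ℝ (E n)) : ℝ :=
  sInf {s | ∃ X Y : ℕ → E n, IsPrincipalFamily A B j X Y ∧ s = psiVec (X j) (Y j)}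

/-- The exponent `μ_n(A|e)_j ∈ [0, ∞]`: the upper bound of all real `β > 0` such that
`ψ_j(A, B) ≤ 1 / H(B) ^ β` for infinitely many rational subspaces `B` of dimension `e`. -/
def exponentOf {n : ℕ} (A : Submodule ℝ (E n)) (e j : ℕ) : ℝ≥0∞ :=
  sSup {x | ∃ β : ℝ, 0 < β ∧ x = ENNReal.ofReal β ∧
    {B | B ∈ rationalSubspaces n e ∧ psi j A B ≤ 1 / height e B ^ β}.Infinite}

/-- The exponent `μ̊_n(d|e)_j ∈ [0, ∞]`: the infimum of `μ_n(A|e)_j` over all `(e, j)`-irrational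
subspaces `A` of dimension `d` of `ℝⁿ`. -/
def exponent (n d e j : ℕ) : ℝ≥0∞ :=
  ⨅ A ∈ irrationalSubspaces n d e j, exponentOf A e j

end SubspaceApprox

end

/-! Put N = d(n - d), the dimension of the Grassmannian. The lower bound is proved in the stronger
form (1/d)(1 + 1/N) (`le_exponent`). Write A in reduced echelon form and approximate its N free
entries simultaneously by Dirichlet's theorem, with a common denominator q ≤ Q^N. The integer rows
obtained span a rational B with H(B) ≪ q^d and ψ_d(A, B) ≪ 1/(qQ) ≤ q^(-1-1/N), so every β < (1 +
1/N)/d is reached. It is reached infinitely often because ψ_d(A, B) never vanishes for irrational A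
(`exists_rational_approx`, `infinite_setOf_psi_le`).

The upper bound is a Borel–Cantelli argument in the chart sending M, in the unit cube of ℝ^N, to the
row space of (I | M) (`exists_chart_of_lt`). The M with ψ_d ≤ ε for a given B form a set of diameter
O(ε), hence of volume O(ε^N). With ε = H(B)^(-β) it remains to sum H(B)^(-βN), which converges for
βN > n (`summable_height_rpow`): by Minkowski's second theorem B has a basis of integer vectors
whose norms have product ≪ H(B), so the sum is dominated by the d-th power of a sum of ‖z‖^(-βN)
over integer vectors. Thus for each β > n/N some nonrational A has exponent at most β. Both bounds
tend to 1/d.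

Canonical angles enter only through a comparison of ψ_d(A, B) with the distances from unit vectors
of A to B (`exists_norm_sub_le_psi`, `psi_le_of_forall_exists`). -/

namespace SubspaceApprox

/-! ### Minors and Plücker coordinates -/

/-- The maximal minor with index set `I` of a family of `e` vectors. -/
def minor {R : Type*} [CommRing R] {n e : ℕ} (v : Fin e → Fin n → R) (I : PluckerIndex n e) : R :=
  (Matrix.of fun i k : Fin e => v k (I.1.orderEmbOfFin I.2 i)).det

/-- Row rank equals column rank: a maximal independent set of the coordinate vectors `w k` has
exactly `e` elements and cuts out an invertible block. The field is arbitrary because `ZMod p` is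
needed as well as `ℝ`. -/
theorem exists_minor_ne_zero {K : Type*} [Field K] {n e : ℕ} {v : Fin e → Fin n → K}
    (hv : LinearIndependent K v) : ∃ I, minor v I ≠ 0 := by
  classical
  set w : Fin n → Fin e → K := fun k i => v i k with hw
  obtain ⟨s, -, -, hspan, hli⟩ := exists_linearIndepOn_extension (K := K) (v := w)
    (linearIndepOn_empty K w) (Set.empty_subset Set.univ)
  have hrank : Module.finrank K (Submodule.span K (Set.range w)) = e := by
    have h := hv.rank_matrix (M := Matrix.of v)
    rw [Matrix.rank_eq_finrank_span_cols] at h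
    rw [Fintype.card_fin] at h
    exact h
  have hcard : s.toFinset.card = e := by
    have h1 : Submodule.span K (w '' s) = Submodule.span K (Set.range w) := by
      refine le_antisymm (Submodule.span_mono (Set.image_subset_range _ _)) ?_
      rw [Submodule.span_le, ← Set.image_univ]
      exact hspan
    have h2 := finrank_span_eq_card hli
    rw [← Set.image_eq_range, h1, hrank] at h2
    rw [h2, Set.toFinset_card]
  refine ⟨⟨s.toFinset, hcard⟩, ?_⟩
  have h3 : LinearIndependent K (fun i : Fin e => w (s.toFinset.orderEmbOfFin hcard i)) := by
    have hm : ∀ i, s.toFinset.orderEmbOfFin hcard i ∈ s := fun i =>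
      Set.mem_toFinset.1 (Finset.orderEmbOfFin_mem s.toFinset hcard i)
    exact hli.comp (fun i => ⟨_, hm i⟩) (fun i j hij => by simpa using hij)
  have h4 : IsUnit (Matrix.of fun i k : Fin e => v k (s.toFinset.orderEmbOfFin hcard i)) :=
    Matrix.linearIndependent_rows_iff_isUnit.1 h3
  exact ((Matrix.isUnit_iff_isUnit_det _).1 h4).ne_zero

theorem linearIndependent_of_minor_ne_zero {K : Type*} [Field K] {n e : ℕ} {v : Fin e → Fin n → K}
    {I : PluckerIndex n e} (h : minor v I ≠ 0) : LinearIndependent K v := by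
  have h1 : LinearIndependent K (fun (k i : Fin e) => v k (I.1.orderEmbOfFin I.2 i)) := by
    have : IsUnit (Matrix.of fun i k : Fin e => v k (I.1.orderEmbOfFin I.2 i)) :=
      (Matrix.isUnit_iff_isUnit_det _).2 (isUnit_iff_ne_zero.2 h)
    exact Matrix.linearIndependent_cols_iff_isUnit.2 this
  exact LinearIndependent.of_comp (LinearMap.funLeft K K fun i => I.1.orderEmbOfFin I.2 i) h1

theorem minor_sum_smul {R : Type*} [CommRing R] {n e : ℕ} (T : Matrix (Fin e) (Fin e) R)
    (v : Fin e → Fin n → R) (I : PluckerIndex n e) :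
    minor (fun k => ∑ j, T k j • v j) I = T.det * minor v I := by
  rw [minor, minor, ← Matrix.det_transpose T, mul_comm, ← Matrix.det_mul]
  congr 1
  ext i k
  simp [Matrix.mul_apply, mul_comm]

theorem minor_map {R S : Type*} [CommRing R] [CommRing S] (f : R →+* S) {n e : ℕ}
    (v : Fin e → Fin n → R) (I : PluckerIndex n e) :
    minor (fun i k => f (v i k)) I = f (minor v I) := by
  rw [minor, minor, RingHom.map_det]
  rfl

theorem plucker_eq_minor {n e : ℕ} (b : Fin e → E n) (I : PluckerIndex n e) :
    plucker b I = minor (fun i k => b i k) I := rfl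

theorem plucker_sum_smul {n e : ℕ} (T : Matrix (Fin e) (Fin e) ℝ) (b : Fin e → E n)
    (I : PluckerIndex n e) :
    plucker (fun k => ∑ j, T k j • b j) I = T.det * plucker b I := by
  rw [plucker_eq_minor, plucker_eq_minor, ← minor_sum_smul]
  congr 1
  ext k i
  simp

theorem linearIndependent_coord_iff {n e : ℕ} {b : Fin e → E n} :
    LinearIndependent ℝ (fun i k => b i k) ↔ LinearIndependent ℝ b :=
  LinearMap.linearIndependent_iff (WithLp.linearEquiv 2 ℝ (Fin n → ℝ)).toLinearMap
    (LinearEquiv.ker _)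

theorem exists_plucker_ne_zero {n e : ℕ} {b : Fin e → E n} (hb : LinearIndependent ℝ b) :
    ∃ I, plucker b I ≠ 0 :=
  exists_minor_ne_zero (linearIndependent_coord_iff.2 hb)

theorem linearIndependent_of_plucker_ne_zero {n e : ℕ} {b : Fin e → E n} {I : PluckerIndex n e}
    (h : plucker b I ≠ 0) : LinearIndependent ℝ b :=
  linearIndependent_coord_iff.1 (linearIndependent_of_minor_ne_zero h)

/-- The Euclidean norm of the vector of Plücker coordinates. -/
noncomputable def pluckerNorm {n e : ℕ} (b : Fin e → E n) : ℝ := √(∑ I, plucker b I ^ 2)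

theorem abs_plucker_le_pluckerNorm {n e : ℕ} (b : Fin e → E n) (I : PluckerIndex n e) :
    |plucker b I| ≤ pluckerNorm b :=
  Real.abs_le_sqrt (Finset.single_le_sum (f := fun I => plucker b I ^ 2)
    (fun _ _ => sq_nonneg _) (Finset.mem_univ I))

theorem pluckerNorm_sum_smul {n e : ℕ} (T : Matrix (Fin e) (Fin e) ℝ) (b : Fin e → E n) :
    pluckerNorm (fun k => ∑ j, T k j • b j) = |T.det| * pluckerNorm b := by
  simp only [pluckerNorm, plucker_sum_smul, mul_pow, ← Finset.mul_sum]
  rw [Real.sqrt_mul (sq_nonneg _), Real.sqrt_sq_eq_abs]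

/-- A multilinear expansion runs over all maps `f`, not only increasing ones: reordering the rows
changes only the sign, and a repeated row gives 0. -/
theorem abs_det_le_pluckerNorm {n e : ℕ} (b : Fin e → E n) (f : Fin e → Fin n) :
    |(Matrix.of fun i k : Fin e => b k (f i)).det| ≤ pluckerNorm b := by
  classical
  by_cases hf : Function.Injective f
  · set I : PluckerIndex n e := ⟨Finset.univ.image f, by
      rw [Finset.card_image_of_injective _ hf]; simp⟩ with hI
    have hr : ∀ i, ∃ j, I.1.orderEmbOfFin I.2 j = f i := fun i => by
      have : f i ∈ Set.range (I.1.orderEmbOfFin I.2) := by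
        rw [Finset.range_orderEmbOfFin]; simp [hI]
      exact this
    choose σ hσ using hr
    have hσi : Function.Injective σ := fun i j hij => hf (by rw [← hσ, ← hσ, hij])
    let τ : Equiv.Perm (Fin e) := Equiv.ofBijective σ (Finite.injective_iff_bijective.1 hσi)
    have h : (Matrix.of fun i k : Fin e => b k (f i)) =
        (Matrix.of fun i k : Fin e => b k (I.1.orderEmbOfFin I.2 i)).submatrix τ id := by
      ext i k
      simp [τ, hσ]
    rw [h, Matrix.det_permute, abs_mul]
    have h2 : |((Equiv.Perm.sign τ : ℤ) : ℝ)| = 1 := by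
      rcases Int.units_eq_one_or (Equiv.Perm.sign τ) with h | h <;> simp [h]
    rw [h2, one_mul]
    exact abs_plucker_le_pluckerNorm b I
  · simp only [Function.Injective, not_forall] at hf
    obtain ⟨i, j, hij, hne⟩ := hf
    rw [Matrix.det_zero_of_row_eq hne (by ext k; simp [hij]), abs_zero]
    exact Real.sqrt_nonneg _

/-- A weak form of the Cauchy-Binet formula. -/
theorem one_le_pluckerNorm_of_orthonormal {n e : ℕ} {o : Fin e → E n} (ho : Orthonormal ℝ o) :
    1 ≤ (n : ℝ) ^ e * pluckerNorm o := by
  classical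
  have h1 : (1 : Matrix (Fin e) (Fin e) ℝ) =
      fun i => ∑ k : Fin n, o i k • (fun j : Fin e => o j k) := by
    ext i j
    have := orthonormal_iff_ite.1 ho i j
    simp only [PiLp.inner_apply] at this
    rw [Matrix.one_apply, ← this, Finset.sum_apply]
    simp [mul_comm]
  -- The Gram matrix is the identity; its determinant is expanded in the rows and the `n ^ e` terms
  -- are bounded one by one.
  have h2 : (1 : ℝ) = ∑ f : Fin e → Fin n, (∏ i, o i (f i)) *
      (Matrix.of fun i k : Fin e => o k (f i)).det := by
    rw [← Matrix.det_one (n := Fin e) (R := ℝ), h1]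
    change Matrix.detRowAlternating.toMultilinearMap _ = _
    rw [MultilinearMap.map_sum]
    refine Finset.sum_congr rfl fun f _ => ?_
    rw [MultilinearMap.map_smul_univ]
    rfl
  have hle : ∀ i k, |o i k| ≤ 1 := fun i k => by
    have := PiLp.norm_apply_le (o i) k
    rwa [ho.1 i] at this
  calc (1 : ℝ) ≤ ∑ f : Fin e → Fin n, |(∏ i, o i (f i)) *
      (Matrix.of fun i k : Fin e => o k (f i)).det| := by
        conv_lhs => rw [h2]
        exact Finset.sum_le_sum fun _ _ => le_abs_self _
    _ ≤ ∑ f : Fin e → Fin n, pluckerNorm o := Finset.sum_le_sum fun f _ => by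
        rw [abs_mul, Finset.abs_prod]
        calc _ ≤ 1 * pluckerNorm o := mul_le_mul
              (Finset.prod_le_one (fun _ _ => abs_nonneg _) fun _ _ => hle _ _)
              (abs_det_le_pluckerNorm o f) (abs_nonneg _) zero_le_one
          _ = _ := one_mul _
    _ = _ := by simp

/-! ### Integer bases and the height -/

/-- An integer vector as an element of Euclidean space. -/
noncomputable def castE {n : ℕ} (z : Fin n → ℤ) : E n := WithLp.toLp 2 fun k => (z k : ℝ)

@[simp] theorem castE_apply {n : ℕ} (z : Fin n → ℤ) (k : Fin n) : castE z k = (z k : ℝ) := rfl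

theorem castE_injective {n : ℕ} : Function.Injective (castE (n := n)) := fun x y h => by
  ext k
  have := congrArg (fun v : E n => v k) h
  simpa using this

theorem castE_sum_smul {n e : ℕ} (c : Fin e → ℤ) (b : Fin e → Fin n → ℤ) :
    castE (∑ i, c i • b i) = ∑ i, (c i : ℝ) • castE (b i) := by
  ext k
  simp

theorem plucker_castE {n e : ℕ} (b : Fin e → Fin n → ℤ) (I : PluckerIndex n e) :
    plucker (fun i => castE (b i)) I = ((minor b I : ℤ) : ℝ) :=
  minor_map (Int.castRingHom ℝ) b I

theorem span_eq_of_linearIndependent {n e : ℕ} {B : Submodule ℝ (E n)} {v : Fin e → E n}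
    (hv : LinearIndependent ℝ v) (hB : ∀ i, v i ∈ B) (hd : Module.finrank ℝ B = e) :
    Submodule.span ℝ (Set.range v) = B := by
  refine Submodule.eq_of_le_of_finrank_eq (Submodule.span_le.2 (Set.range_subset_iff.2 hB)) ?_
  rw [finrank_span_eq_card hv, hd, Fintype.card_fin]

theorem finrank_of_mem_rationalSubspaces {n e : ℕ} {B : Submodule ℝ (E n)}
    (hB : B ∈ rationalSubspaces n e) : Module.finrank ℝ B = e := by
  obtain ⟨b, -, hb, rfl⟩ := hB
  rw [finrank_span_eq_card hb, Fintype.card_fin]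

theorem mem_rationalSubspaces_of_castE {n e : ℕ} {b : Fin e → Fin n → ℤ}
    (hb : LinearIndependent ℝ fun i => castE (b i)) :
    Submodule.span ℝ (Set.range fun i => castE (b i)) ∈ rationalSubspaces n e :=
  ⟨fun i => castE (b i), fun i k => ⟨b i k, by simp⟩, hb, rfl⟩

theorem exists_integer_basis {n e : ℕ} {B : Submodule ℝ (E n)} (hB : B ∈ rationalSubspaces n e) :
    ∃ b : Fin e → Fin n → ℤ, LinearIndependent ℝ (fun i => castE (b i)) ∧ ∀ i, castE (b i) ∈ B := by
  obtain ⟨v, hv, hli, rfl⟩ := hB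
  choose r hr using hv
  set D : ℕ := ∏ i, ∏ k, (r i k).den with hD
  have hD0 : (D : ℝ) ≠ 0 := by
    simp [hD, Finset.prod_eq_zero_iff]
  have hint : ∀ i k, ∃ z : ℤ, (z : ℝ) = D * v i k := fun i k => by
    have h1 : (r i k).den ∣ D :=
      (Finset.dvd_prod_of_mem (fun k => (r i k).den) (Finset.mem_univ k)).trans
        (Finset.dvd_prod_of_mem (fun i => ∏ k, (r i k).den) (Finset.mem_univ i))
    obtain ⟨m, hm⟩ := h1
    refine ⟨(r i k).num * m, ?_⟩
    rw [hr, hm]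
    have h2 : ((r i k : ℚ) : ℝ) = (r i k).num / (r i k).den := by exact_mod_cast (Rat.num_div_den _).symm
    have h3 : ((r i k).den : ℝ) ≠ 0 := by exact_mod_cast (r i k).den_ne_zero
    rw [h2]
    push_cast
    field_simp
  choose b hb using hint
  have hbv : ∀ i, castE (b i) = (D : ℝ) • v i := fun i => by
    ext k
    simp [hb]
  refine ⟨b, ?_, fun i => ?_⟩
  · have := hli.units_smul (fun _ => Units.mk0 (D : ℝ) hD0)
    convert this using 1
    ext1 i
    rw [hbv]
    rfl
  · rw [hbv]
    exact Submodule.smul_mem _ _ (Submodule.subset_span ⟨i, rfl⟩)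

/-- Cramer's rule in column `j`. The form with `a • w` avoids division, so that it applies over `ℤ`
to a combination divisible by a prime `a`. -/
theorem minor_update_sum {R : Type*} [CommRing R] {n e : ℕ} (v : Fin e → Fin n → R)
    (I : PluckerIndex n e) (j : Fin e) (c : Fin e → R) (a : R) (w : Fin n → R)
    (hw : a • w = ∑ i, c i • v i) : a * minor (Function.update v j w) I = c j * minor v I := by
  have h1 : ∀ w : Fin n → R, minor (Function.update v j w) I =
      ((Matrix.of fun i k : Fin e => v k (I.1.orderEmbOfFin I.2 i)).updateCol j
        (fun i => w (I.1.orderEmbOfFin I.2 i))).det := fun w => by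
    rw [minor]
    congr 1
    ext i k
    by_cases h : k = j
    · subst h; simp
    · simp [h]
  have h2 := Matrix.det_updateCol_sum
    (Matrix.of fun i k : Fin e => v k (I.1.orderEmbOfFin I.2 i)) j c
  rw [h1, ← Matrix.det_updateCol_smul, minor, ← smul_eq_mul, ← h2]
  congr 2
  ext i
  have := congrFun hw (I.1.orderEmbOfFin I.2 i)
  simpa using this

theorem exists_minor_ne_zero_of_castE {n e : ℕ} {b : Fin e → Fin n → ℤ}
    (hb : LinearIndependent ℝ fun i => castE (b i)) : ∃ I, minor b I ≠ 0 := by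
  obtain ⟨I, hI⟩ := exists_plucker_ne_zero hb
  rw [plucker_castE] at hI
  exact ⟨I, by exact_mod_cast hI⟩

theorem linearIndependent_castE {n e : ℕ} {b : Fin e → Fin n → ℤ} {I : PluckerIndex n e}
    (h : minor b I ≠ 0) : LinearIndependent ℝ fun i => castE (b i) :=
  linearIndependent_of_plucker_ne_zero (I := I) (by rw [plucker_castE]; exact_mod_cast h)

/-- A rational subspace has a basis of integer vectors whose minors are setwise coprime. -/
theorem exists_primitive_basis {n e : ℕ} {B : Submodule ℝ (E n)} (hB : B ∈ rationalSubspaces n e) :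
    ∃ b : Fin e → Fin n → ℤ, LinearIndependent ℝ (fun i => castE (b i)) ∧
      (∀ i, castE (b i) ∈ B) ∧ Finset.univ.gcd (minor b) = 1 := by
  classical
  -- Take an integer basis with the least sum of absolute values of minors. If a prime `p` divided
  -- all minors, the vectors would be dependent mod `p`, and a lifted relation divided by `p` would
  -- give a replacement for one of them that lowers the sum.
  obtain ⟨b, ⟨hb, hbB⟩, hmin⟩ := (measure fun b : Fin e → Fin n → ℤ =>
    ∑ I, (minor b I).natAbs).wf.has_min
    {b | LinearIndependent ℝ (fun i => castE (b i)) ∧ ∀ i, castE (b i) ∈ B}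
    (exists_integer_basis hB)
  refine ⟨b, hb, hbB, ?_⟩
  obtain ⟨I₀, hI₀⟩ := exists_minor_ne_zero_of_castE hb
  by_contra hg
  have hg1 : (Finset.univ.gcd (minor b)).natAbs ≠ 1 := fun h => by
    apply hg
    rw [← Finset.normalize_gcd, ← Int.abs_eq_normalize, Int.abs_eq_natAbs, h]
    rfl
  obtain ⟨p, hp, hpd⟩ := Nat.exists_prime_and_dvd hg1
  have : Fact p.Prime := ⟨hp⟩
  have hpm : ∀ I, (p : ℤ) ∣ minor b I := fun I =>
    (Int.natCast_dvd.2 hpd).trans (Finset.gcd_dvd (Finset.mem_univ I))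
  have hdep : ¬ LinearIndependent (ZMod p) (fun i k => (b i k : ZMod p)) := fun h => by
    obtain ⟨I, hI⟩ := exists_minor_ne_zero h
    apply hI
    have := minor_map (Int.castRingHom (ZMod p)) b I
    simp only [eq_intCast] at this
    rw [this]
    exact (ZMod.intCast_zmod_eq_zero_iff_dvd _ _).2 (hpm I)
  obtain ⟨g, hg0, j, hj⟩ := Fintype.not_linearIndependent_iff.1 hdep
  -- Representatives in `[0, p)` make the ratio `c j / p` of new minors to old ones smaller than 1,
  -- and positive since `g j ≠ 0`.
  set c : Fin e → ℤ := fun i => ((g i).val : ℤ) with hc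
  have hdvd : ∀ k, (p : ℤ) ∣ (∑ i, c i • b i) k := fun k => by
    rw [← ZMod.intCast_zmod_eq_zero_iff_dvd]
    have := congrFun hg0 k
    simp only [Finset.sum_apply, Pi.smul_apply, smul_eq_mul, Pi.zero_apply] at this ⊢
    rw [← this]
    push_cast
    simp [hc]
  choose w hw using hdvd
  have hw' : (p : ℤ) • w = ∑ i, c i • b i := by
    ext k
    rw [hw k]
    simp
  have hp0 : (0 : ℤ) < p := by exact_mod_cast hp.pos
  have hcj : 0 < c j := by
    have : (g j).val ≠ 0 := fun h => hj ((ZMod.val_eq_zero _).1 h)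
    simp only [hc]
    omega
  have hcp : c j < p := by
    simp only [hc]
    exact_mod_cast ZMod.val_lt (g j)
  have hmul := fun I => minor_update_sum b I j c (p : ℤ) w hw'
  have habs : ∀ I, p * (minor (Function.update b j w) I).natAbs =
      (c j).natAbs * (minor b I).natAbs := fun I => by
    have := congrArg Int.natAbs (hmul I)
    simpa [Int.natAbs_mul] using this
  have hcp' : (c j).natAbs < p := by omega
  have hle : ∀ I, (minor (Function.update b j w) I).natAbs ≤ (minor b I).natAbs := fun I => by
    refine Nat.le_of_mul_le_mul_left ?_ hp.pos
    rw [habs I]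
    exact Nat.mul_le_mul_right _ hcp'.le
  refine hmin (Function.update b j w) ⟨?_, fun i => ?_⟩ ?_
  · refine linearIndependent_castE (I := I₀) fun h => ?_
    have := hmul I₀
    rw [h, mul_zero] at this
    exact (mul_ne_zero hcj.ne' hI₀) this.symm
  · by_cases h : i = j
    · subst h
      have h1 : castE w = (p : ℝ)⁻¹ • ∑ i, (c i : ℝ) • castE (b i) := by
        rw [← castE_sum_smul, ← hw']
        ext k
        have : (p : ℝ) ≠ 0 := by exact_mod_cast hp.ne_zero
        simp [this]
      simp only [Function.update_self, h1]
      exact B.smul_mem _ (B.sum_mem fun i _ => B.smul_mem _ (hbB i))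
    · simpa [h] using hbB i
  · refine Finset.sum_lt_sum (fun I _ => hle I) ⟨I₀, Finset.mem_univ _, ?_⟩
    refine Nat.lt_of_mul_lt_mul_left (a := p) ?_
    rw [habs I₀]
    exact Nat.mul_lt_mul_of_pos_right hcp' (Int.natAbs_pos.2 hI₀)

theorem exists_matrix_of_span_eq {n e : ℕ} {b b' : Fin e → E n}
    (h : ∀ i, b' i ∈ Submodule.span ℝ (Set.range b)) :
    ∃ T : Matrix (Fin e) (Fin e) ℝ, b' = fun k => ∑ j, T k j • b j := by
  have h1 : ∀ i, ∃ c : Fin e → ℝ, ∑ j, c j • b j = b' i := fun i =>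
    Submodule.mem_span_range_iff_exists_fun ℝ |>.1 (h i)
  choose T hT using h1
  exact ⟨T, funext fun k => (hT k).symm⟩

theorem sqrt_sum_minor_sq {n e : ℕ} (b : Fin e → Fin n → ℤ) :
    √(∑ I, ((minor b I : ℤ) : ℝ) ^ 2) = pluckerNorm fun i => castE (b i) := by
  simp only [pluckerNorm, plucker_castE]

/-- Coprimality of the minors of `b` makes each of them divide the same coordinate of any integer
vector in the class, so `minor b` has the least norm. This settles the infimum without proving
uniqueness up to sign. -/
theorem height_eq_of_primitive {n e : ℕ} {B : Submodule ℝ (E n)} {b : Fin e → Fin n → ℤ}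
    (hb : LinearIndependent ℝ fun i => castE (b i))
    (hB : Submodule.span ℝ (Set.range fun i => castE (b i)) = B)
    (hg : Finset.univ.gcd (minor b) = 1) :
    height e B = pluckerNorm fun i => castE (b i) := by
  rw [← sqrt_sum_minor_sq]
  refine IsLeast.csInf_eq ⟨⟨minor b, ⟨hg, _, hb, hB, 1, fun I => ?_⟩, rfl⟩, ?_⟩
  · rw [one_mul, plucker_castE]
  · rintro h ⟨Ξ, ⟨hΞ, b', hb', hB', c, hc⟩, rfl⟩
    obtain ⟨T, hT⟩ := exists_matrix_of_span_eq (b := fun i => castE (b i)) (b' := b') fun i => by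
      rw [hB, ← hB']; exact Submodule.subset_span ⟨i, rfl⟩
    have hprop : ∀ I, (Ξ I : ℝ) = c * T.det * minor b I := fun I => by
      rw [hc, hT, plucker_sum_smul, plucker_castE, mul_assoc]
    have hcross : ∀ I J, Ξ J * minor b I = minor b J * Ξ I := fun I J => by
      have : (Ξ J : ℝ) * minor b I = minor b J * Ξ I := by rw [hprop I, hprop J]; ring
      exact_mod_cast this
    have hdvd : ∀ J, minor b J ∣ Ξ J := fun J => by
      have h1 : minor b J ∣ Finset.univ.gcd fun I => Ξ J * minor b I :=
        Finset.dvd_gcd fun I _ => ⟨Ξ I, hcross I J⟩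
      rw [Finset.gcd_mul_left, hg, mul_one] at h1
      exact dvd_normalize_iff.1 h1
    refine Real.sqrt_le_sqrt (Finset.sum_le_sum fun J _ => ?_)
    -- Divisibility bounds absolute values only when `Ξ J ≠ 0`. If `Ξ J = 0`, a nonzero minor would
    -- force `c * T.det`, hence all of `Ξ`, to vanish.
    by_cases hJ : Ξ J = 0
    · have : minor b J = 0 := by
        by_contra hne
        have h0 : c * T.det = 0 := by
          have := hprop J
          rw [hJ, Int.cast_zero] at this
          exact (mul_eq_zero.1 this.symm).resolve_right (by exact_mod_cast hne)
        have hz : ∀ I, Ξ I = 0 := fun I => by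
          have := hprop I
          rw [h0, zero_mul] at this
          exact_mod_cast this
        rw [Finset.gcd_eq_zero_iff.2 fun I _ => hz I] at hΞ
        exact zero_ne_one hΞ
      simp [hJ, this]
    · have := Int.natAbs_le_of_dvd_ne_zero (hdvd J) hJ
      have h2 : (minor b J) ^ 2 ≤ (Ξ J) ^ 2 := Int.natAbs_le_iff_sq_le.1 this
      exact_mod_cast h2

theorem exists_basis_height_eq {n e : ℕ} {B : Submodule ℝ (E n)} (hB : B ∈ rationalSubspaces n e) :
    ∃ b : Fin e → Fin n → ℤ, LinearIndependent ℝ (fun i => castE (b i)) ∧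
      Submodule.span ℝ (Set.range fun i => castE (b i)) = B ∧
      height e B = pluckerNorm fun i => castE (b i) := by
  obtain ⟨b, hb, hbB, hg⟩ := exists_primitive_basis hB
  have hs := span_eq_of_linearIndependent hb hbB (finrank_of_mem_rationalSubspaces hB)
  exact ⟨b, hb, hs, height_eq_of_primitive hb hs hg⟩

theorem one_le_pluckerNorm_castE {n e : ℕ} {b : Fin e → Fin n → ℤ}
    (hb : LinearIndependent ℝ fun i => castE (b i)) : 1 ≤ pluckerNorm fun i => castE (b i) := by
  obtain ⟨I, hI⟩ := exists_minor_ne_zero_of_castE hb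
  refine le_trans ?_ (abs_plucker_le_pluckerNorm _ I)
  rw [plucker_castE]
  exact_mod_cast Int.one_le_abs hI

theorem one_le_height {n e : ℕ} {B : Submodule ℝ (E n)} (hB : B ∈ rationalSubspaces n e) :
    1 ≤ height e B := by
  obtain ⟨b, hb, -, h⟩ := exists_basis_height_eq hB
  rw [h]
  exact one_le_pluckerNorm_castE hb

/-- Dividing the minors by their gcd gives a primitive vector of the class, and this cannot increase
the norm. -/
theorem height_le_pluckerNorm {n e : ℕ} {b : Fin e → Fin n → ℤ}
    (hb : LinearIndependent ℝ fun i => castE (b i)) :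
    height e (Submodule.span ℝ (Set.range fun i => castE (b i))) ≤
      pluckerNorm fun i => castE (b i) := by
  obtain ⟨I₀, hI₀⟩ := exists_minor_ne_zero_of_castE hb
  set g := Finset.univ.gcd (minor b) with hg
  have hg0 : g ≠ 0 := fun h => hI₀ (Finset.gcd_eq_zero_iff.1 h I₀ (Finset.mem_univ _))
  have hdiv : ∀ I, minor b I / g * g = minor b I := fun I =>
    Int.ediv_mul_cancel (Finset.gcd_dvd (Finset.mem_univ I))
  have hmem : √(∑ I, ((minor b I / g : ℤ) : ℝ) ^ 2) ∈ {h | ∃ Ξ : PluckerIndex n e → ℤ,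
      IsPrimitivePlucker (Submodule.span ℝ (Set.range fun i => castE (b i))) Ξ ∧
      h = √(∑ I, (Ξ I : ℝ) ^ 2)} := by
    refine ⟨fun I => minor b I / g, ⟨Finset.gcd_div_eq_one (Finset.mem_univ I₀) hI₀, _, hb, rfl,
      (g : ℝ)⁻¹, fun I => ?_⟩, rfl⟩
    have : (g : ℝ) ≠ 0 := by exact_mod_cast hg0
    rw [plucker_castE, eq_inv_mul_iff_mul_eq₀ this, mul_comm]
    exact_mod_cast hdiv I
  refine (csInf_le ⟨0, ?_⟩ hmem).trans ?_
  · rintro _ ⟨Ξ, -, rfl⟩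
    exact Real.sqrt_nonneg _
  · rw [← sqrt_sum_minor_sq]
    refine Real.sqrt_le_sqrt (Finset.sum_le_sum fun I _ => ?_)
    have h2 : (minor b I / g) ^ 2 ≤ (minor b I) ^ 2 := by
      conv_rhs => rw [← hdiv I, mul_pow]
      have : 0 < g ^ 2 := by positivity
      nlinarith [sq_nonneg (minor b I / g)]
    exact_mod_cast h2

/-! ### Geometry of numbers -/

/-- Minkowski's first theorem, for the lattice `G ℤᵈ` and cubes. -/
theorem pow_le_abs_det {d : ℕ} (G : Matrix (Fin d) (Fin d) ℝ) {δ : ℝ} (hδ : 0 < δ)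
    (hG : G.det ≠ 0)
    (h : ∀ z : Fin d → ℤ, z ≠ 0 → ∃ i, δ ≤ |G.mulVec (fun j => (z j : ℝ)) i|) :
    δ ^ d ≤ |G.det| := by
  by_contra! hlt
  set f : (Fin d → ℝ) →ₗ[ℝ] (Fin d → ℝ) := Matrix.toLin' G with hf
  have hdet : LinearMap.det f = G.det := LinearMap.det_toLin' G
  -- This preimage of a cube has volume `(2 * δ) ^ d / |G.det|`, which exceeds `2 ^ d` under the
  -- negated claim, so it contains a nonzero integer point.
  set s : Set (Fin d → ℝ) := f ⁻¹' Metric.ball 0 δ with hs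
  have hvol : MeasureTheory.volume s = ENNReal.ofReal (|G.det|⁻¹ * (2 * δ) ^ d) := by
    rw [hs, MeasureTheory.Measure.addHaar_preimage_linearMap _ (by rwa [hdet]), hdet,
      Real.volume_pi_ball _ hδ, Fintype.card_fin, ← ENNReal.ofReal_mul (abs_nonneg _), abs_inv]
  have hfund := ZSpan.isAddFundamentalDomain' (Pi.basisFun ℝ (Fin d)) MeasureTheory.volume
  have hF : MeasureTheory.volume (ZSpan.fundamentalDomain (Pi.basisFun ℝ (Fin d))) = 1 := by
    rw [ZSpan.fundamentalDomain_pi_basisFun, Real.volume_pi_Ico]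
    simp
  have hpos : 0 < |G.det| := abs_pos.2 hG
  have : Countable (Submodule.span ℤ (Set.range (Pi.basisFun ℝ (Fin d)))).toAddSubgroup :=
    inferInstanceAs (Countable (Submodule.span ℤ (Set.range (Pi.basisFun ℝ (Fin d)))))
  obtain ⟨x, hx0, hx⟩ :=
    MeasureTheory.exists_ne_zero_mem_lattice_of_measure_mul_two_pow_lt_measure (s := s) hfund
      (fun x hx => by simpa [hs] using hx)
      ((convex_ball _ _).linear_preimage f) (by
        rw [hF, hvol, one_mul, Module.finrank_fin_fun]
        rw [show (2 : ℝ≥0∞) ^ d = ENNReal.ofReal (2 ^ d) by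
          rw [ENNReal.ofReal_pow zero_le_two]; simp]
        refine (ENNReal.ofReal_lt_ofReal_iff (by positivity)).2 ?_
        rw [lt_inv_mul_iff₀ hpos, mul_pow, mul_comm]
        gcongr)
  have hmem := x.2
  have hz : ∀ i, ∃ m : ℤ, (m : ℝ) = (x : Fin d → ℝ) i := fun i => by
    have := (Module.Basis.mem_span_iff_repr_mem ℤ (Pi.basisFun ℝ (Fin d)) (x : Fin d → ℝ)).1 hmem i
    simpa using this
  choose z hz using hz
  have hz0 : z ≠ 0 := fun h0 => hx0 <| Subtype.ext <| funext fun i => by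
    rw [← hz i, h0]; simp
  obtain ⟨i, hi⟩ := h z hz0
  have h1 : ‖f (x : Fin d → ℝ)‖ < δ := by simpa [hs] using hx
  have h2 := (norm_le_pi_norm (f (x : Fin d → ℝ)) i).trans_lt h1
  rw [hf, Matrix.toLin'_apply, ← funext hz, Real.norm_eq_abs] at h2
  exact absurd hi (not_le.2 h2)

/-- Recursive choice of the first `d` terms of a sequence. -/
theorem exists_seq {α : Type*} [Nonempty α] (d : ℕ) (P : ℕ → (ℕ → α) → α → Prop)
    (hP : ∀ i X X' a, (∀ j < i, X j = X' j) → P i X a → P i X' a)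
    (h : ∀ i < d, ∀ X, (∀ j < i, P j X (X j)) → ∃ a, P i X a) :
    ∃ X : ℕ → α, ∀ i < d, P i X (X i) := by
  induction d with
  | zero => exact ⟨fun _ => Classical.arbitrary α, fun i hi => absurd hi (Nat.not_lt_zero i)⟩
  | succ d ih =>
    obtain ⟨X, hX⟩ := ih fun i hi => h i (hi.trans d.lt_succ_self)
    obtain ⟨a, ha⟩ := h d d.lt_succ_self X hX
    have hup : ∀ i ≤ d, ∀ j < i, X j = Function.update X d a j := fun i hi j hj => by
      rw [Function.update_of_ne (by omega)]
    refine ⟨Function.update X d a, fun i hi => ?_⟩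
    rcases Nat.lt_succ_iff_lt_or_eq.1 hi with hi | rfl
    · rw [Function.update_of_ne hi.ne]
      exact hP i X _ _ (hup i hi.le) (hX i hi)
    · rw [Function.update_self]
      exact hP i X _ _ (hup i le_rfl) ha

theorem norm_castE_sq {n : ℕ} (z : Fin n → ℤ) : ‖castE z‖ ^ 2 = ((∑ k, z k ^ 2 : ℤ) : ℝ) := by
  rw [EuclideanSpace.norm_sq_eq]
  simp

/-- Successive minima of the integer points of a rational subspace. -/
theorem exists_successive_minima {n d : ℕ} {B : Submodule ℝ (E n)}
    (hB : B ∈ rationalSubspaces n d) :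
    ∃ x : Fin d → Fin n → ℤ, LinearIndependent ℝ (fun i => castE (x i)) ∧ (∀ i, castE (x i) ∈ B) ∧
      ∀ i, ∀ v, castE v ∈ B →
        castE v ∉ Submodule.span ℝ ((fun j => castE (x j)) '' Set.Iio i) →
        ‖castE (x i)‖ ≤ ‖castE v‖ := by
  set S : ℕ → (ℕ → Fin n → ℤ) → Submodule ℝ (E n) := fun i X =>
    Submodule.span ℝ ((fun j => castE (X j)) '' Set.Iio i) with hS
  have hScongr : ∀ i X X', (∀ j < i, X j = X' j) → S i X = S i X' := fun i X X' hX => by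
    simp only [hS]
    congr 1
    exact Set.image_congr fun j hj => by rw [hX j hj]
  obtain ⟨X, hX⟩ := exists_seq d (fun i X a => castE a ∈ B ∧ castE a ∉ S i X ∧
      ∀ v, castE v ∈ B → castE v ∉ S i X → ‖castE a‖ ≤ ‖castE v‖)
    (fun i X X' a hXX' => by rw [hScongr i X X' hXX']; exact id)
    (fun i hi X _ => by
      -- The earlier choices span at most `i < d` dimensions, so some vector of an integer basis of
      -- `B` lies outside their span.
      have hne : {v : Fin n → ℤ | castE v ∈ B ∧ castE v ∉ S i X}.Nonempty := by
        by_contra hemp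
        rw [Set.not_nonempty_iff_eq_empty, Set.eq_empty_iff_forall_notMem] at hemp
        obtain ⟨b, hb, hbB⟩ := exists_integer_basis hB
        have hle : Submodule.span ℝ (Set.range fun i => castE (b i)) ≤ S i X := by
          rw [Submodule.span_le]
          rintro _ ⟨k, rfl⟩
          by_contra hk
          exact hemp (b k) ⟨hbB k, hk⟩
        have h1 := Submodule.finrank_mono hle
        rw [finrank_span_eq_card hb, Fintype.card_fin] at h1
        have h2 : Module.finrank ℝ (S i X) ≤ i := by
          have : S i X = Submodule.span ℝ (Set.range fun j : Fin i => castE (X j)) := by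
            simp only [hS]
            congr 1
            ext y
            simp only [Set.mem_image, Set.mem_Iio, Set.mem_range]
            exact ⟨fun ⟨j, hj, h⟩ => ⟨⟨j, hj⟩, h⟩, fun ⟨j, h⟩ => ⟨j, j.2, h⟩⟩
          rw [this]
          have h3 := finrank_range_le_card (R := ℝ) fun j : Fin i => castE (X j)
          rwa [Fintype.card_fin] at h3
        omega
      obtain ⟨a, ha, hmin⟩ := (measure fun v : Fin n → ℤ =>
        (∑ k, v k ^ 2).toNat).wf.has_min _ hne
      refine ⟨a, ha.1, ha.2, fun v hv hvS => ?_⟩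
      have h3 : (∑ k, a k ^ 2).toNat ≤ (∑ k, v k ^ 2).toNat := not_lt.1 (hmin v ⟨hv, hvS⟩)
      have h4 : ∑ k, a k ^ 2 ≤ ∑ k, v k ^ 2 := by
        have h5 : 0 ≤ ∑ k, v k ^ 2 := Finset.sum_nonneg fun _ _ => sq_nonneg _
        omega
      refine le_of_sq_le_sq ?_ (norm_nonneg _)
      rw [norm_castE_sq, norm_castE_sq]
      exact_mod_cast h4)
  have hli : ∀ m ≤ d, LinearIndependent ℝ fun i : Fin m => castE (X i) := by
    intro m
    induction m with
    | zero => exact fun _ => linearIndependent_empty_type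
    | succ m ih =>
      intro hm
      refine linearIndependent_finSucc'.2 ⟨ih (by omega), ?_⟩
      have h1 := (hX m (by omega)).2.1
      intro h2
      apply h1
      refine Submodule.span_mono ?_ h2
      rintro _ ⟨j, rfl⟩
      exact ⟨j, j.2, rfl⟩
  refine ⟨fun i => X i, hli d le_rfl, fun i => (hX i i.2).1, fun i v hv hvs => ?_⟩
  refine (hX i i.2).2.2 v hv fun hmem => hvs ?_
  refine Submodule.span_mono ?_ hmem
  rintro _ ⟨j, hj, rfl⟩
  exact ⟨⟨j, lt_trans hj i.2⟩, hj, rfl⟩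

theorem inner_eq_zero_of_mem_span {n d : ℕ} {o : Fin d → E n} (ho : Orthonormal ℝ o)
    {S : Set (Fin d)} {v : E n} (hv : v ∈ Submodule.span ℝ (o '' S)) {j : Fin d} (hj : j ∉ S) :
    inner ℝ (o j) v = 0 := by
  induction hv using Submodule.span_induction with
  | mem x hx =>
    obtain ⟨i, hi, rfl⟩ := hx
    exact ho.2 fun h => hj (h ▸ hi)
  | zero => simp
  | add x y _ _ hx hy => rw [inner_add_right, hx, hy, add_zero]
  | smul a x _ hx => rw [inner_smul_right, hx, mul_zero]

theorem eq_sum_inner_of_mem_span {n d : ℕ} {o : Fin d → E n} (ho : Orthonormal ℝ o)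
    {v : E n} (hv : v ∈ Submodule.span ℝ (Set.range o)) :
    v = ∑ i, (inner ℝ (o i) v : ℝ) • o i := by
  obtain ⟨c, rfl⟩ := (Submodule.mem_span_range_iff_exists_fun ℝ).1 hv
  simp only [ho.inner_right_fintype]

/-- Minkowski's second theorem, up to a constant, for the integer points of a rational subspace. -/
theorem exists_prod_norm_le_height {n d : ℕ} (hd : 1 ≤ d) {B : Submodule ℝ (E n)}
    (hB : B ∈ rationalSubspaces n d) :
    ∃ x : Fin d → Fin n → ℤ, (∀ i, x i ≠ 0) ∧
      Submodule.span ℝ (Set.range fun i => castE (x i)) = B ∧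
      ∏ i, ‖castE (x i)‖ ≤ (d : ℝ) ^ d * (n : ℝ) ^ d * height d B := by
  obtain ⟨x, hx, hxB, hmin⟩ := exists_successive_minima hB
  obtain ⟨b, hb, hbB, hH⟩ := exists_basis_height_eq hB
  have hfr := finrank_of_mem_rationalSubspaces hB
  have hspan := span_eq_of_linearIndependent hx hxB hfr
  have hy0 : ∀ i, castE (x i) ≠ 0 := fun i => hx.ne_zero i
  refine ⟨x, fun i h => hy0 i (by rw [h]; ext; simp), hspan, ?_⟩
  set y : Fin d → E n := fun i => castE (x i) with hy
  -- Gram–Schmidt preserves the flag: the minima before `k` and the orthonormal vectors before `k`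
  -- have the same span.
  set o : Fin d → E n := InnerProductSpace.gramSchmidtNormed ℝ y with ho_def
  have ho : Orthonormal ℝ o := InnerProductSpace.gramSchmidtNormed_orthonormal hx
  have hoB : Submodule.span ℝ (Set.range o) = B := by
    rw [ho_def, InnerProductSpace.span_gramSchmidtNormed_range, InnerProductSpace.span_gramSchmidt,
      hspan]
  have hoIio : ∀ k, Submodule.span ℝ (y '' Set.Iio k) = Submodule.span ℝ (o '' Set.Iio k) :=
    fun k => by
      rw [ho_def, InnerProductSpace.span_gramSchmidtNormed,
        InnerProductSpace.span_gramSchmidt_Iio]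
  set T : Matrix (Fin d) (Fin d) ℝ := fun i k => inner ℝ (o k) (castE (b i)) with hT
  have hbT : (fun i => castE (b i)) = fun i => ∑ k, T i k • o k := funext fun i =>
    eq_sum_inner_of_mem_span ho (by rw [hoB, ← hbB]; exact Submodule.subset_span ⟨i, rfl⟩)
  have hdetT : pluckerNorm (fun i => castE (b i)) = |T.det| * pluckerNorm o := by
    rw [hbT, pluckerNorm_sum_smul]
  have hone := one_le_pluckerNorm_castE hb
  have hTdet : T.det ≠ 0 := fun h => by
    rw [hdetT, h, abs_zero, zero_mul] at hone
    exact absurd hone (by norm_num)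
  have hl : ∀ i, 0 < ‖y i‖ := fun i => norm_pos_iff.2 (hy0 i)
  have hprod : 0 < ∏ i, ‖y i‖ := Finset.prod_pos fun i _ => hl i
  -- `G` sends `z` to the orthonormal coordinates of `∑ z i • b i`, the `k`-th divided by the `k`-th
  -- minimum. Minkowski's first theorem with `δ = 1 / d` then bounds the product of the minima.
  set G : Matrix (Fin d) (Fin d) ℝ := Matrix.diagonal (fun i => ‖y i‖⁻¹) * T.transpose with hG
  have hGdet : G.det = (∏ i, ‖y i‖)⁻¹ * T.det := by
    rw [hG, Matrix.det_mul, Matrix.det_diagonal, Matrix.det_transpose, Finset.prod_inv_distrib]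
  have hd0 : (0 : ℝ) < d := by exact_mod_cast hd
  have hmink : ((d : ℝ)⁻¹) ^ d ≤ |G.det| := by
    refine pow_le_abs_det G (by positivity) ?_ fun z hz => ?_
    · rw [hGdet]
      exact mul_ne_zero (inv_ne_zero hprod.ne') hTdet
    set v : Fin n → ℤ := ∑ i, z i • b i with hv
    have hvs : castE v = ∑ i, (z i : ℝ) • castE (b i) := castE_sum_smul z b
    have hvB : castE v ∈ B := by
      rw [hvs, ← hbB]
      exact Submodule.sum_mem _ fun i _ => Submodule.smul_mem _ _ (Submodule.subset_span ⟨i, rfl⟩)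
    have hGv : ∀ k, G.mulVec (fun j => (z j : ℝ)) k = ‖y k‖⁻¹ * inner ℝ (o k) (castE v) :=
      fun k => by
        rw [hG, ← Matrix.mulVec_mulVec, Matrix.mulVec_diagonal, hvs, inner_sum]
        simp only [inner_smul_right, Matrix.mulVec, dotProduct, hT]
        simp only [mul_comm]
        rfl
    have hexp := eq_sum_inner_of_mem_span ho (v := castE v) (by rwa [hoB])
    have hv0 : castE v ≠ 0 := fun h0 => by
      rw [hvs] at h0
      apply hz
      ext i
      have := Fintype.linearIndependent_iff.1 hb _ h0 i
      exact_mod_cast this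
    have hne : (Finset.univ.filter fun k => (inner ℝ (o k) (castE v) : ℝ) ≠ 0).Nonempty := by
      by_contra hemp
      rw [Finset.not_nonempty_iff_eq_empty, Finset.filter_eq_empty_iff] at hemp
      apply hv0
      rw [hexp]
      exact Finset.sum_eq_zero fun i hi => by rw [not_not.1 (hemp hi), zero_smul]
    -- Let `k` be the last nonzero coordinate. Then `v` is outside the span of the minima before
    -- `k`, so `‖y k‖ ≤ ‖castE v‖`; if all scaled coordinates were below `1 / d`, the triangle
    -- inequality would contradict this.
    obtain ⟨k, hk, hkmax⟩ := Finset.exists_max_image _ id hne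
    rw [Finset.mem_filter] at hk
    have hk0 : ∀ j, k < j → (inner ℝ (o j) (castE v) : ℝ) = 0 := fun j hj => by
      by_contra hc
      exact absurd (hkmax j (by simp [hc])) (not_le.2 hj)
    have hnot : castE v ∉ Submodule.span ℝ (y '' Set.Iio k) := fun hmem => by
      rw [hoIio] at hmem
      exact hk.2 (inner_eq_zero_of_mem_span ho hmem (by simp))
    have hlk : ‖y k‖ ≤ ‖castE v‖ := hmin k v hvB hnot
    have hmono : ∀ j ≤ k, ‖y j‖ ≤ ‖y k‖ := fun j hj => by
      refine hmin j (x k) (hxB k) fun hmem => ?_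
      have : y k ∉ Submodule.span ℝ (y '' Set.Iio j) :=
        LinearIndependent.notMem_span_image hx (by simpa using hj)
      exact this hmem
    by_contra! hcon
    have hlt : ∀ j, ‖(inner ℝ (o j) (castE v) : ℝ) • o j‖ < ‖y k‖ * (d : ℝ)⁻¹ := fun j => by
      rw [norm_smul, ho.1, mul_one, Real.norm_eq_abs]
      rcases le_or_gt j k with hj | hj
      · have h1 := hcon j
        rw [hGv, abs_mul, abs_of_pos (inv_pos.2 (hl j)), inv_mul_lt_iff₀ (hl j)] at h1
        exact h1.trans_le (mul_le_mul_of_nonneg_right (hmono j hj) (by positivity))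
      · rw [hk0 j hj, abs_zero]
        exact mul_pos (hl k) (by positivity)
    have : ‖castE v‖ < ‖y k‖ := calc
      ‖castE v‖ ≤ ∑ j, ‖(inner ℝ (o j) (castE v) : ℝ) • o j‖ := by
          conv_lhs => rw [hexp]
          exact norm_sum_le _ _
      _ < ∑ _j : Fin d, ‖y k‖ * (d : ℝ)⁻¹ :=
          Finset.sum_lt_sum_of_nonempty ⟨k, Finset.mem_univ k⟩ fun j _ => hlt j
      _ = ‖y k‖ := by
          rw [Finset.sum_const, Finset.card_univ, Fintype.card_fin, nsmul_eq_mul]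
          field_simp
    exact absurd hlk (not_le.2 this)
  rw [hGdet, abs_mul, abs_of_pos (inv_pos.2 hprod), le_inv_mul_iff₀ hprod, inv_pow,
    ← div_eq_mul_inv, div_le_iff₀ (by positivity)] at hmink
  have hCB := one_le_pluckerNorm_of_orthonormal ho
  calc ∏ i, ‖y i‖ ≤ |T.det| * (d : ℝ) ^ d * 1 := by rwa [mul_one]
    _ ≤ |T.det| * (d : ℝ) ^ d * ((n : ℝ) ^ d * pluckerNorm o) := by gcongr
    _ = _ := by rw [hH, hdetT]; ring

/-! ### Summation over rational subspaces -/

theorem summable_norm_castE_rpow {n : ℕ} {s : ℝ} (hs : (n : ℝ) < s) :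
    Summable fun z : Fin n → ℤ => ‖castE z‖ ^ (-s) := by
  set b : Module.Basis (Fin n) ℝ (E n) := (EuclideanSpace.basisFun (Fin n) ℝ).toBasis
  set L : Submodule ℤ (E n) := Submodule.span ℤ (Set.range b) with hL
  have hrank : Module.finrank ℤ L = n := by
    rw [ZLattice.rank ℝ L]
    simp
  have h1 := ZLattice.summable_norm_rpow L (-s) (by rw [hrank]; linarith)
  have hmem : ∀ z : Fin n → ℤ, castE z ∈ L := fun z => by
    rw [hL, Module.Basis.mem_span_iff_repr_mem ℤ b]
    intro i
    exact ⟨z i, by simp [b]⟩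
  exact h1.comp_injective (i := fun z : Fin n → ℤ => (⟨castE z, hmem z⟩ : L))
    fun x y h => castE_injective (congrArg Subtype.val h)

/-- A finite set of tuples lies in a box, over which the sum of products factors. -/
theorem summable_prod_of_nonneg {ι κ : Type*} [Fintype ι] {f : κ → ℝ} (hf : ∀ x, 0 ≤ f x)
    (hs : Summable f) : Summable fun x : ι → κ => ∏ i, f (x i) := by
  classical
  refine summable_of_sum_le (c := (∑' x, f x) ^ Fintype.card ι)
    (fun x => Finset.prod_nonneg fun i _ => hf _) fun u => ?_
  set t : Finset κ := u.biUnion fun x => Finset.univ.image x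
  calc ∑ x ∈ u, ∏ i, f (x i) ≤ ∑ x ∈ Fintype.piFinset fun _ : ι => t, ∏ i, f (x i) := by
        refine Finset.sum_le_sum_of_subset_of_nonneg (fun x hx => ?_) fun x _ _ =>
          Finset.prod_nonneg fun i _ => hf _
        rw [Fintype.mem_piFinset]
        exact fun i => Finset.mem_biUnion.2 ⟨x, hx, by simp⟩
    _ = ∏ _i : ι, ∑ x ∈ t, f x := (Finset.prod_univ_sum (fun _ => t) fun _ => f).symm
    _ ≤ ∏ _i : ι, ∑' x, f x := Finset.prod_le_prod
        (fun _ _ => Finset.sum_nonneg fun _ _ => hf _)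
        fun _ _ => hs.sum_le_tsum _ fun _ _ => hf _
    _ = _ := by simp

/-- Convergence of the height zeta function of the rational subspaces of dimension `d`. -/
theorem summable_height_rpow {n d : ℕ} (hd : 1 ≤ d) {s : ℝ} (hs : (n : ℝ) < s) :
    Summable fun B : rationalSubspaces n d => height d B.1 ^ (-s) := by
  -- The tuple `x B` spans `B`, hence determines it: the series is dominated by one over `d`-tuples
  -- of integer vectors.
  choose x hx0 hxB hx using fun B : rationalSubspaces n d => exists_prod_norm_le_height hd B.2
  have hinj : Function.Injective x := fun B B' h => Subtype.ext <| by
    rw [← hxB B, ← hxB B', h]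
  have h1 := ((summable_prod_of_nonneg (ι := Fin d) (fun z => Real.rpow_nonneg (norm_nonneg _) _)
    (summable_norm_castE_rpow hs)).comp_injective hinj).mul_left
      (((d : ℝ) ^ d * (n : ℝ) ^ d) ^ s)
  refine Summable.of_nonneg_of_le (fun B => ?_) (fun B => ?_) h1
  · exact Real.rpow_nonneg (zero_le_one.trans (one_le_height B.2)) _
  · have hs0 : 0 < s := (Nat.cast_nonneg n).trans_lt hs
    have hH := zero_lt_one.trans_le (one_le_height B.2)
    have hpos : 0 < ∏ i, ‖castE (x B i)‖ := Finset.prod_pos fun i _ => norm_pos_iff.2 fun h =>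
      hx0 B i (castE_injective (h.trans (by ext; simp)))
    have h2 := Real.rpow_le_rpow hpos.le (hx B) hs0.le
    rw [Real.mul_rpow (by positivity) hH.le] at h2
    simp only [Function.comp]
    rw [Real.finsetProd_rpow _ _ fun i _ => norm_nonneg _, Real.rpow_neg hH.le,
      Real.rpow_neg hpos.le, ← div_eq_mul_inv, inv_eq_one_div,
      div_le_div_iff₀ (Real.rpow_pos_of_pos hH _) (Real.rpow_pos_of_pos hpos _), one_mul]
    exact h2

theorem countable_rationalSubspaces (n e : ℕ) : (rationalSubspaces n e).Countable := by
  refine (Set.countable_range fun r : Fin e → Fin n → ℚ =>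
    Submodule.span ℝ (Set.range fun i => (WithLp.toLp 2 fun k => (r i k : ℝ) : E n))).mono ?_
  rintro B ⟨b, hb, -, rfl⟩
  choose r hr using hb
  refine ⟨r, ?_⟩
  have : (fun i => (WithLp.toLp 2 fun k => (r i k : ℝ) : E n)) = b := by
    ext i k
    simp [hr]
  simp only [this]

/-! ### Canonical angles -/

theorem psiVec_nonneg {n : ℕ} (X Y : E n) : 0 ≤ psiVec X Y :=
  InnerProductGeometry.sin_angle_nonneg X Y

theorem psiVec_comm {n : ℕ} (X Y : E n) : psiVec X Y = psiVec Y X := by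
  rw [psiVec, psiVec, InnerProductGeometry.angle_comm]

theorem psiVec_sq_mul {n : ℕ} (X Y : E n) :
    psiVec X Y ^ 2 * (‖X‖ ^ 2 * ‖Y‖ ^ 2) = ‖X‖ ^ 2 * ‖Y‖ ^ 2 - (inner ℝ X Y : ℝ) ^ 2 := by
  have h := InnerProductGeometry.cos_angle_mul_norm_mul_norm X Y
  rw [← h, psiVec, Real.sin_sq]
  ring

theorem norm_sub_inner_smul {n : ℕ} {X Y : E n} (hX : ‖X‖ = 1) (hY : ‖Y‖ = 1) :
    ‖X - (inner ℝ X Y : ℝ) • Y‖ = psiVec X Y := by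
  have h := psiVec_sq_mul X Y
  rw [hX, hY] at h
  refine (sq_eq_sq₀ (norm_nonneg _) (psiVec_nonneg X Y)).1 ?_
  rw [norm_sub_sq_real, inner_smul_right, norm_smul, hX, hY, mul_one, Real.norm_eq_abs, sq_abs]
  linarith

/-- A vector of `V` orthogonal to the direction of `V` nearest to `X` is orthogonal to `X`. -/
theorem inner_eq_zero_of_psiVec_minimal {n : ℕ} {V : Submodule ℝ (E n)} {X Y Z : E n}
    (hX : ‖X‖ = 1) (hY : ‖Y‖ = 1) (hYV : Y ∈ V) (hZV : Z ∈ V) (hYZ : (inner ℝ Y Z : ℝ) = 0)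
    (hmin : ∀ Y' ∈ V, Y' ≠ 0 → psiVec X Y ≤ psiVec X Y') : (inner ℝ X Z : ℝ) = 0 := by
  by_contra hb
  set a : ℝ := inner ℝ X Y with ha
  set b : ℝ := inner ℝ X Z with hbdef
  have hZ : Z ≠ 0 := fun h => hb (by rw [hbdef, h, inner_zero_right])
  set m : ℝ := ‖Z‖ ^ 2 with hm
  have hm0 : 0 < m := by have := norm_pos_iff.2 hZ; positivity
  -- `W` is `m` times the orthogonal projection of `X` on the plane of `Y` and `Z`; for `b ≠ 0` it
  -- makes a strictly smaller angle with the line of `X` than `Y` does.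
  set W : E n := (a * m) • Y + b • Z with hW
  have hb2 : 0 < b ^ 2 := by positivity
  have h1 : (inner ℝ X W : ℝ) = a ^ 2 * m + b ^ 2 := by
    rw [hW, inner_add_right, inner_smul_right, inner_smul_right, ← ha, ← hbdef]; ring
  have h2 : ‖W‖ ^ 2 = m * (a ^ 2 * m + b ^ 2) := by
    rw [hW, norm_add_sq_real, norm_smul, norm_smul, inner_smul_left, inner_smul_right, hYZ, hY,
      mul_pow, mul_pow, ← hm, Real.norm_eq_abs, Real.norm_eq_abs, sq_abs, sq_abs]
    ring
  have hc0 : 0 < a ^ 2 * m + b ^ 2 := by positivity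
  have hW0 : W ≠ 0 := fun h => by
    rw [h, norm_zero] at h2
    have : 0 < m * (a ^ 2 * m + b ^ 2) := by positivity
    linarith
  have h3 := hmin W (V.add_mem (V.smul_mem _ hYV) (V.smul_mem _ hZV)) hW0
  have h4 := pow_le_pow_left₀ (psiVec_nonneg X Y) h3 2
  have h5 := psiVec_sq_mul X Y
  have h6 := psiVec_sq_mul X W
  rw [hX, hY, ← ha] at h5
  rw [hX, h1, h2] at h6
  have h7 : psiVec X Y ^ 2 = 1 - a ^ 2 := by linarith
  have h8 : (1 - a ^ 2) * (m * (a ^ 2 * m + b ^ 2)) ≤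
      m * (a ^ 2 * m + b ^ 2) - (a ^ 2 * m + b ^ 2) ^ 2 := by
    rw [← h7]
    calc _ ≤ psiVec X W ^ 2 * (m * (a ^ 2 * m + b ^ 2)) := by gcongr
      _ = _ := by linarith
  nlinarith [mul_pos hc0 hb2]

theorem IsPrincipalFamily.symm {n : ℕ} {A B : Submodule ℝ (E n)} {j : ℕ} {X Y : ℕ → E n}
    (h : IsPrincipalFamily A B j X Y) : IsPrincipalFamily B A j Y X := fun i hi => by
  obtain ⟨h1, h2, h3, h4, h5⟩ := h i hi
  refine ⟨h2, h1, h4, h3, fun X' hX' Y' hY' hX0 hY0 => ?_⟩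
  rw [psiVec_comm, psiVec_comm X']
  exact h5 Y' hY' X' hX' hY0 hX0

theorem psi_comm {n : ℕ} (j : ℕ) (A B : Submodule ℝ (E n)) : psi j A B = psi j B A := by
  have h : ∀ A B : Submodule ℝ (E n),
      {s | ∃ X Y : ℕ → E n, IsPrincipalFamily A B j X Y ∧ s = psiVec (X j) (Y j)} ⊆
      {s | ∃ X Y : ℕ → E n, IsPrincipalFamily B A j X Y ∧ s = psiVec (X j) (Y j)} := by
    rintro A B s ⟨X, Y, hXY, rfl⟩
    exact ⟨Y, X, hXY.symm, psiVec_comm _ _⟩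
  rw [psi, psi, Set.Subset.antisymm (h A B) (h B A)]

theorem orthPart_anti {n : ℕ} (A : Submodule ℝ (E n)) (X : ℕ → E n) {i k : ℕ} (h : i ≤ k) :
    orthPart A X k ≤ orthPart A X i :=
  inf_le_inf_left _ (Submodule.orthogonal_le (Submodule.span_mono
    (Set.image_mono (Set.Icc_subset_Icc_right h))))

theorem inner_eq_zero_of_mem_orthPart {n : ℕ} {A : Submodule ℝ (E n)} {X : ℕ → E n} {i k : ℕ}
    {Z : E n} (hZ : Z ∈ orthPart A X k) (h : i < k) : (inner ℝ (X (i + 1)) Z : ℝ) = 0 :=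
  (Submodule.mem_orthogonal _ _).1 hZ.2 _
    (Submodule.subset_span ⟨i + 1, ⟨by omega, by omega⟩, rfl⟩)

namespace IsPrincipalFamily

variable {n : ℕ} {A B : Submodule ℝ (E n)} {j : ℕ} {X Y : ℕ → E n}

theorem orthonormal (h : IsPrincipalFamily A B j X Y) :
    Orthonormal ℝ fun i : Fin j => X (i + 1) := by
  refine ⟨fun i => (h i i.2).2.2.1, fun i k hik => ?_⟩
  rcases lt_or_gt_of_ne (Fin.val_ne_of_ne hik) with hlt | hlt
  · exact inner_eq_zero_of_mem_orthPart (h k k.2).1 hlt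
  · rw [real_inner_comm]
    exact inner_eq_zero_of_mem_orthPart (h i i.2).1 hlt

/-- At stage `i`, `Y (i + 1)` is the best direction for `X (i + 1)` in a space that still contains
`Y (k + 1)`, which is orthogonal to `Y (i + 1)`. -/
theorem inner_eq_zero_of_lt (h : IsPrincipalFamily A B j X Y) {i k : ℕ} (hik : i < k) (hk : k < j) :
    (inner ℝ (X (i + 1)) (Y (k + 1)) : ℝ) = 0 := by
  obtain ⟨h1, h2, h3, h4, h5⟩ := h i (hik.trans hk)
  have hYk := (h k hk).2.1
  refine inner_eq_zero_of_psiVec_minimal h3 h4 h2 (orthPart_anti B Y hik.le hYk)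
    (inner_eq_zero_of_mem_orthPart hYk hik) fun Y' hY' hY0 => h5 _ h1 Y' hY' ?_ hY0
  exact norm_ne_zero_iff.1 (by rw [h3]; exact one_ne_zero)

theorem inner_eq_zero (h : IsPrincipalFamily A B j X Y) {i k : ℕ} (hi : i < j) (hk : k < j)
    (hik : i ≠ k) : (inner ℝ (X (i + 1)) (Y (k + 1)) : ℝ) = 0 := by
  rcases lt_or_gt_of_ne hik with hlt | hlt
  · exact h.inner_eq_zero_of_lt hlt hk
  · rw [real_inner_comm]
    exact h.symm.inner_eq_zero_of_lt hlt hi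

theorem psiVec_le (h : IsPrincipalFamily A B j X Y) {i : ℕ} (hi : i < j) :
    psiVec (X (i + 1)) (Y (i + 1)) ≤ psiVec (X j) (Y j) := by
  obtain ⟨k, rfl⟩ : ∃ k, j = k + 1 := ⟨j - 1, by omega⟩
  obtain ⟨h1, h2, h3, h4, -⟩ := h k k.lt_succ_self
  refine (h i hi).2.2.2.2 _ (orthPart_anti A X (by omega) h1) _ (orthPart_anti B Y (by omega) h2)
    ?_ ?_
  · exact norm_ne_zero_iff.1 (by rw [h3]; exact one_ne_zero)
  · exact norm_ne_zero_iff.1 (by rw [h4]; exact one_ne_zero)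

theorem span_eq (h : IsPrincipalFamily A B j X Y) (hA : Module.finrank ℝ A = j) :
    Submodule.span ℝ (Set.range fun i : Fin j => X (i + 1)) = A :=
  span_eq_of_linearIndependent h.orthonormal.linearIndependent (fun i => (h i i.2).1.1) hA

/-- Expand `x` in the orthonormal basis of the `X i` and project each `X i` on the line of `Y i`.
Each projection error is a sine, at most the last one; the factor `j` counts the terms. -/
theorem exists_norm_sub_le (h : IsPrincipalFamily A B j X Y) (hA : Module.finrank ℝ A = j)
    {x : E n} (hx : x ∈ A) : ∃ y ∈ B, ‖x - y‖ ≤ j * ‖x‖ * psiVec (X j) (Y j) := by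
  have hxs := eq_sum_inner_of_mem_span h.orthonormal (v := x) (by rwa [h.span_eq hA])
  set c : Fin j → ℝ := fun i => inner ℝ (X (i + 1)) x with hc
  refine ⟨∑ i : Fin j, c i • (inner ℝ (X (i + 1)) (Y (i + 1)) : ℝ) • Y (i + 1),
    B.sum_mem fun i _ => B.smul_mem _ (B.smul_mem _ (h i i.2).2.1.1), ?_⟩
  conv_lhs => rw [hxs]
  rw [← Finset.sum_sub_distrib]
  calc _ ≤ ∑ i : Fin j, ‖c i • X (i + 1) -
        c i • (inner ℝ (X (i + 1)) (Y (i + 1)) : ℝ) • Y (i + 1)‖ := norm_sum_le _ _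
    _ ≤ ∑ _i : Fin j, ‖x‖ * psiVec (X j) (Y j) := Finset.sum_le_sum fun i _ => by
        rw [← smul_sub, norm_smul, norm_sub_inner_smul (h i i.2).2.2.1 (h i i.2).2.2.2.1]
        refine mul_le_mul ?_ (h.psiVec_le i.2) (psiVec_nonneg _ _) (norm_nonneg _)
        have := abs_real_inner_le_norm (X (i + 1)) x
        rwa [(h i i.2).2.2.1, one_mul] at this
    _ = _ := by simp [mul_assoc]

/-- The `Y i` span `B`, and `X j` is orthogonal to all of them but the last. So its projection on
`B` lies on the line of `Y j`, and the sine is its distance to `B`. -/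
theorem psiVec_le_norm_sub (h : IsPrincipalFamily A B j X Y) (hB : Module.finrank ℝ B = j)
    (hj : 1 ≤ j) {y : E n} (hy : y ∈ B) : psiVec (X j) (Y j) ≤ ‖X j - y‖ := by
  obtain ⟨k, rfl⟩ : ∃ k, j = k + 1 := ⟨j - 1, by omega⟩
  obtain ⟨h1, h2, h3, h4, -⟩ := h k k.lt_succ_self
  set a : ℝ := inner ℝ (X (k + 1)) (Y (k + 1)) with ha
  have horth : ∀ z ∈ B, (inner ℝ (X (k + 1) - a • Y (k + 1)) z : ℝ) = 0 := fun z hz => by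
    rw [← h.symm.span_eq hB] at hz
    induction hz using Submodule.span_induction with
    | mem z hz =>
      obtain ⟨i, rfl⟩ := hz
      rw [inner_sub_left, real_inner_smul_left]
      dsimp only
      by_cases hi : (i : ℕ) = k
      · rw [hi, ← ha, real_inner_self_eq_norm_sq, h4]; ring
      · have h6 : (inner ℝ (Y (k + 1)) (Y (i + 1)) : ℝ) = 0 := by
          rw [real_inner_comm]
          exact inner_eq_zero_of_mem_orthPart h2 (by omega)
        rw [h.inner_eq_zero k.lt_succ_self i.2 (Ne.symm hi), h6]; ring
    | zero => simp
    | add u v _ _ hu hv => rw [inner_add_right, hu, hv, add_zero]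
    | smul t u _ hu => rw [inner_smul_right, hu, mul_zero]
  rw [← norm_sub_inner_smul h3 h4, ← ha]
  refine le_of_sq_le_sq ?_ (norm_nonneg _)
  have h7 : X (k + 1) - y = (X (k + 1) - a • Y (k + 1)) + (a • Y (k + 1) - y) := by abel
  rw [h7, norm_add_sq_real (X (k + 1) - a • Y (k + 1)),
    horth _ (B.sub_mem (B.smul_mem _ h2.1) hy)]
  nlinarith [sq_nonneg ‖a • Y (k + 1) - y‖]

end IsPrincipalFamily

theorem exists_ne_zero_mem_orthPart {n : ℕ} {A : Submodule ℝ (E n)} (X : ℕ → E n) {i : ℕ}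
    (hi : i < Module.finrank ℝ A) : ∃ x ∈ orthPart A X i, ‖x‖ = 1 := by
  set S := Submodule.span ℝ (X '' Set.Icc 1 i) with hS
  have h1 : Module.finrank ℝ S ≤ i := by
    classical
    have h : S = Submodule.span ℝ ((Finset.Icc 1 i).image X : Set (E n)) := by
      rw [hS]; push_cast; rfl
    rw [h]
    refine (finrank_span_finset_le_card _).trans (Finset.card_image_le.trans ?_)
    simp
  have h2 := S.finrank_add_finrank_orthogonal
  have h3 := Submodule.finrank_sup_add_finrank_inf_eq A Sᗮ
  have h4 := Submodule.finrank_le (A ⊔ Sᗮ)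
  have h5 : orthPart A X i ≠ ⊥ := fun h => by
    have h6 : A ⊓ Sᗮ = ⊥ := h
    rw [h6, finrank_bot] at h3
    omega
  obtain ⟨x, hx, hx0⟩ := Submodule.exists_mem_ne_zero_of_ne_bot h5
  exact ⟨‖x‖⁻¹ • x, Submodule.smul_mem _ _ hx, norm_smul_inv_norm hx0⟩

theorem exists_psiVec_minimal {n : ℕ} {V W : Submodule ℝ (E n)} (hV : ∃ x ∈ V, ‖x‖ = 1)
    (hW : ∃ x ∈ W, ‖x‖ = 1) : ∃ X ∈ V, ∃ Y ∈ W, ‖X‖ = 1 ∧ ‖Y‖ = 1 ∧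
      ∀ X' ∈ V, ∀ Y' ∈ W, X' ≠ 0 → Y' ≠ 0 → psiVec X Y ≤ psiVec X' Y' := by
  have hcpt : ∀ V : Submodule ℝ (E n), IsCompact ((V : Set (E n)) ∩ Metric.sphere 0 1) := fun V =>
    (isCompact_sphere _ _).inter_left V.closed_of_finiteDimensional
  have hne : ∀ {x : E n}, ‖x‖ = 1 → x ≠ 0 := fun h =>
    norm_ne_zero_iff.1 (by rw [h]; exact one_ne_zero)
  obtain ⟨x, hx, hx1⟩ := hV
  obtain ⟨y, hy, hy1⟩ := hW
  obtain ⟨p, hp, hmin⟩ := ((hcpt V).prod (hcpt W)).exists_isMinOn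
    (f := fun p => psiVec p.1 p.2) ⟨(x, y), ⟨hx, by simpa using hx1⟩, hy, by simpa using hy1⟩
    (fun p hp => by
      have h1 : p.1 ≠ 0 := hne (by simpa using hp.1.2)
      have h2 : p.2 ≠ 0 := hne (by simpa using hp.2.2)
      exact (Real.continuous_sin.continuousAt.comp
        (InnerProductGeometry.continuousAt_angle h1 h2)).continuousWithinAt)
  refine ⟨p.1, hp.1.1, p.2, hp.2.1, by simpa using hp.1.2, by simpa using hp.2.2,
    fun X' hX' Y' hY' hX0 hY0 => ?_⟩
  have h := isMinOn_iff.1 hmin (‖X'‖⁻¹ • X', ‖Y'‖⁻¹ • Y')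
    ⟨⟨V.smul_mem _ hX', by simp [norm_smul, hX0]⟩, W.smul_mem _ hY', by simp [norm_smul, hY0]⟩
  simp only [psiVec] at h ⊢
  rwa [InnerProductGeometry.angle_smul_left_of_pos _ _ (inv_pos.2 (norm_pos_iff.2 hX0)),
    InnerProductGeometry.angle_smul_right_of_pos _ _ (inv_pos.2 (norm_pos_iff.2 hY0))] at h

theorem exists_isPrincipalFamily {n j : ℕ} {A B : Submodule ℝ (E n)}
    (hA : j ≤ Module.finrank ℝ A) (hB : j ≤ Module.finrank ℝ B) :
    ∃ X Y, IsPrincipalFamily A B j X Y := by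
  have hcongr : ∀ (A : Submodule ℝ (E n)) (i : ℕ) (X X' : ℕ → E n), (∀ j < i, X j = X' j) →
      orthPart A (fun m => X (m - 1)) i = orthPart A (fun m => X' (m - 1)) i := by
    intro A i X X' h
    simp only [orthPart]
    congr 3
    exact Set.image_congr fun m hm => h _ (by have := hm.1; have := hm.2; omega)
  -- Principal families are indexed from 1 and `exists_seq` from 0, hence the shift `m - 1`.
  obtain ⟨F, hF⟩ := exists_seq j (fun i (F : ℕ → E n × E n) a =>
      a.1 ∈ orthPart A (fun m => (F (m - 1)).1) i ∧ a.2 ∈ orthPart B (fun m => (F (m - 1)).2) i ∧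
      ‖a.1‖ = 1 ∧ ‖a.2‖ = 1 ∧ ∀ X' ∈ orthPart A (fun m => (F (m - 1)).1) i,
        ∀ Y' ∈ orthPart B (fun m => (F (m - 1)).2) i, X' ≠ 0 → Y' ≠ 0 →
          psiVec a.1 a.2 ≤ psiVec X' Y')
    (fun i F F' a h => by
      rw [hcongr A i (fun m => (F m).1) (fun m => (F' m).1) fun j hj => by rw [h j hj],
        hcongr B i (fun m => (F m).2) (fun m => (F' m).2) fun j hj => by rw [h j hj]]
      exact id)
    (fun i hi F _ => by
      obtain ⟨X, hX, Y, hY, h⟩ := exists_psiVec_minimal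
        (exists_ne_zero_mem_orthPart (A := A) (fun m => (F (m - 1)).1) (hi.trans_le hA))
        (exists_ne_zero_mem_orthPart (A := B) (fun m => (F (m - 1)).2) (hi.trans_le hB))
      exact ⟨(X, Y), hX, hY, h⟩)
  exact ⟨fun m => (F (m - 1)).1, fun m => (F (m - 1)).2, hF⟩

theorem psi_nonneg {n : ℕ} (j : ℕ) (A B : Submodule ℝ (E n)) : 0 ≤ psi j A B :=
  Real.sInf_nonneg (by rintro _ ⟨X, Y, -, rfl⟩; exact psiVec_nonneg _ _)

/-- With `psi_le_of_forall_exists`, this replaces canonical families by distances to `B`, at the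
cost of a factor `d`. -/
theorem exists_norm_sub_le_psi {n d : ℕ} {A B : Submodule ℝ (E n)}
    (hA : Module.finrank ℝ A = d) (hB : Module.finrank ℝ B = d) {x : E n} (hx : x ∈ A) :
    ∃ y ∈ B, ‖x - y‖ ≤ d * ‖x‖ * psi d A B := by
  obtain ⟨X₀, Y₀, h₀⟩ := exists_isPrincipalFamily hA.ge hB.ge
  obtain ⟨y, hy, hxy⟩ := B.closed_of_finiteDimensional.exists_infDist_eq_dist ⟨0, B.zero_mem⟩ x
  refine ⟨y, hy, ?_⟩
  rw [← dist_eq_norm, ← hxy]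
  -- The distance to `B` does not depend on the family, so a bound valid for every family passes to
  -- the infimum defining `psi`.
  have hle : ∀ s ∈ {s | ∃ X Y : ℕ → E n, IsPrincipalFamily A B d X Y ∧ s = psiVec (X d) (Y d)},
      Metric.infDist x B ≤ d * ‖x‖ * s := by
    rintro _ ⟨X, Y, h, rfl⟩
    obtain ⟨z, hz, hxz⟩ := h.exists_norm_sub_le hA hx
    exact (Metric.infDist_le_dist_of_mem hz).trans (by rwa [dist_eq_norm])
  have hmem : psiVec (X₀ d) (Y₀ d) ∈
      {s | ∃ X Y : ℕ → E n, IsPrincipalFamily A B d X Y ∧ s = psiVec (X d) (Y d)} :=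
    ⟨X₀, Y₀, h₀, rfl⟩
  rcases (by positivity : 0 ≤ (d : ℝ) * ‖x‖).eq_or_lt with h0 | h0
  · have := hle _ hmem
    rw [← h0, zero_mul] at this ⊢
    exact this
  · rw [← div_le_iff₀' h0]
    refine le_csInf ⟨_, hmem⟩ fun s hs => ?_
    rw [div_le_iff₀' h0]
    exact hle s hs

theorem psi_le_of_forall_exists {n d : ℕ} (hd : 1 ≤ d) {A B : Submodule ℝ (E n)}
    (hA : Module.finrank ℝ A = d) (hB : Module.finrank ℝ B = d) {ε : ℝ}
    (h : ∀ x ∈ A, ‖x‖ = 1 → ∃ y ∈ B, ‖x - y‖ ≤ ε) : psi d A B ≤ ε := by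
  obtain ⟨X, Y, hXY⟩ := exists_isPrincipalFamily hA.ge hB.ge
  have hX : X d ∈ A ∧ ‖X d‖ = 1 := by
    have h1 := hXY (d - 1) (by omega)
    rw [Nat.sub_add_cancel hd] at h1
    exact ⟨h1.1.1, h1.2.2.1⟩
  obtain ⟨y, hy, hxy⟩ := h _ hX.1 hX.2
  have hle : psi d A B ≤ psiVec (X d) (Y d) := by
    refine csInf_le ⟨0, ?_⟩ ⟨X, Y, hXY, rfl⟩
    rintro _ ⟨X, Y, -, rfl⟩
    exact psiVec_nonneg _ _
  exact hle.trans ((hXY.psiVec_le_norm_sub hB hd hy).trans hxy)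

theorem psi_pos {n d : ℕ} {A B : Submodule ℝ (E n)} (hA : Module.finrank ℝ A = d)
    (hB : Module.finrank ℝ B = d) (hAB : A ≠ B) : 0 < psi d A B := by
  refine (psi_nonneg d A B).lt_of_ne' fun h0 => hAB ?_
  refine Submodule.eq_of_le_of_finrank_eq (fun x hx => ?_) (hA.trans hB.symm)
  obtain ⟨y, hy, hxy⟩ := exists_norm_sub_le_psi hA hB hx
  rw [h0, mul_zero] at hxy
  have : x = y := sub_eq_zero.1 (norm_le_zero_iff.1 hxy)
  rwa [this]

/-! ### Lower bound: Dirichlet approximation on the Grassmannian -/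

/-- Dirichlet's theorem on simultaneous approximation. -/
theorem exists_simultaneous_approx {ι : Type*} [Fintype ι] (ξ : ι → ℝ) {Q : ℕ} (hQ : 1 ≤ Q) :
    ∃ q : ℕ, 1 ≤ q ∧ q ≤ Q ^ Fintype.card ι ∧ ∃ p : ι → ℤ, ∀ i, |q * ξ i - p i| ≤ 1 / Q := by
  classical
  have hQ0 : (0 : ℝ) < Q := by exact_mod_cast hQ
  have hfl : ∀ (a : ℕ) i, ⌊Int.fract (a * ξ i) * Q⌋₊ < Q := fun a i => by
    rw [Nat.floor_lt (mul_nonneg (Int.fract_nonneg _) hQ0.le)]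
    nlinarith [Int.fract_lt_one ((a : ℝ) * ξ i)]
  -- Pigeonhole: `Q ^ m + 1` multiples of `ξ`, with `m` the number of coordinates, fall mod 1 into
  -- `Q ^ m` boxes of side `1 / Q`.
  obtain ⟨a, b, hab, heq⟩ := Fintype.exists_ne_map_eq_of_card_lt
    (fun (a : Fin (Q ^ Fintype.card ι + 1)) (i : ι) =>
      (⟨⌊Int.fract (((a : ℕ) : ℝ) * ξ i) * Q⌋₊, hfl a i⟩ : Fin Q)) (by simp)
  wlog hlt : b < a generalizing a b
  · exact this b a hab.symm heq.symm (lt_of_le_of_ne (not_lt.1 hlt) hab)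
  have hlt' : (b : ℕ) < a := hlt
  refine ⟨a - b, by omega, by have := a.2; omega,
    fun i => ⌊((a : ℕ) : ℝ) * ξ i⌋ - ⌊((b : ℕ) : ℝ) * ξ i⌋, fun i => ?_⟩
  have h1 : ⌊Int.fract (((a : ℕ) : ℝ) * ξ i) * Q⌋₊ = ⌊Int.fract (((b : ℕ) : ℝ) * ξ i) * Q⌋₊ := by
    simpa using congrFun heq i
  set x := Int.fract (((a : ℕ) : ℝ) * ξ i) with hx
  set y := Int.fract (((b : ℕ) : ℝ) * ξ i) with hy
  have hx0 : 0 ≤ x * Q := mul_nonneg (Int.fract_nonneg _) hQ0.le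
  have hy0 : 0 ≤ y * Q := mul_nonneg (Int.fract_nonneg _) hQ0.le
  have h2 : |x * Q - y * Q| ≤ 1 := by
    have h3 := Nat.floor_le hx0
    have h4 := Nat.lt_floor_add_one (x * Q)
    have h5 := Nat.floor_le hy0
    have h6 := Nat.lt_floor_add_one (y * Q)
    rw [h1] at h3 h4
    rw [abs_le]
    constructor <;> linarith
  rw [← sub_mul, abs_mul, abs_of_pos hQ0] at h2
  rw [le_div_iff₀ hQ0]
  have h7 : (((a : ℕ) - (b : ℕ) : ℕ) : ℝ) * ξ i -
      ((⌊((a : ℕ) : ℝ) * ξ i⌋ - ⌊((b : ℕ) : ℝ) * ξ i⌋ : ℤ) : ℝ) = x - y := by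
    rw [hx, hy, Nat.cast_sub hlt'.le, Int.fract, Int.fract]
    push_cast
    ring
  rwa [h7]

theorem sqrt_sum_sq_le {ι : Type*} [Fintype ι] {f : ι → ℝ} {M : ℝ} (hM : 0 ≤ M)
    (h : ∀ i, |f i| ≤ M) : √(∑ i, f i ^ 2) ≤ Fintype.card ι * M := by
  rw [Real.sqrt_le_left (by positivity)]
  calc ∑ i, f i ^ 2 ≤ ∑ _i : ι, M ^ 2 := Finset.sum_le_sum fun i _ => sq_le_sq' (by
        linarith [neg_abs_le (f i), h i]) ((le_abs_self _).trans (h i))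
    _ = (Fintype.card ι : ℝ) * M ^ 2 := by simp
    _ ≤ (Fintype.card ι : ℝ) ^ 2 * M ^ 2 := by
        gcongr
        exact_mod_cast Nat.le_self_pow two_ne_zero _
    _ = _ := by ring

theorem norm_le_card_mul {n : ℕ} {v : E n} {M : ℝ} (hM : 0 ≤ M) (h : ∀ k, |v k| ≤ M) :
    ‖v‖ ≤ n * M := by
  rw [EuclideanSpace.norm_eq]
  simpa using sqrt_sum_sq_le hM h

/-- A subspace has a basis in reduced echelon form. -/
theorem exists_echelon_basis {n d : ℕ} {A : Submodule ℝ (E n)} (hA : Module.finrank ℝ A = d) :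
    ∃ (I : PluckerIndex n d) (a : Fin d → E n), Submodule.span ℝ (Set.range a) = A ∧
      ∀ i k, a i (I.1.orderEmbOfFin I.2 k) = if i = k then 1 else 0 := by
  set v : Fin d → E n := fun i => (Module.finBasisOfFinrankEq ℝ A hA i : E n) with hv
  have hvli : LinearIndependent ℝ v :=
    (Module.finBasisOfFinrankEq ℝ A hA).linearIndependent.map' A.subtype A.ker_subtype
  obtain ⟨I, hI⟩ := exists_plucker_ne_zero hvli
  set M : Matrix (Fin d) (Fin d) ℝ := Matrix.of fun i k => v k (I.1.orderEmbOfFin I.2 i) with hM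
  have hMt : IsUnit M.transpose.det := by
    rw [Matrix.det_transpose]; exact isUnit_iff_ne_zero.2 hI
  set T := M.transpose⁻¹ with hT
  have hdelta : ∀ i k, (∑ j, T i j • v j) (I.1.orderEmbOfFin I.2 k) = if i = k then 1 else 0 := by
    intro i k
    have h := congrFun (congrFun (Matrix.nonsing_inv_mul _ hMt) i) k
    rw [Matrix.mul_apply, Matrix.one_apply] at h
    rw [← h]
    simp [hM]
    rfl
  refine ⟨I, fun i => ∑ j, T i j • v j, ?_, hdelta⟩
  refine span_eq_of_linearIndependent ?_ (fun i => A.sum_mem fun j _ => A.smul_mem _ (by simp [hv]))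
    hA
  refine linearIndependent_of_plucker_ne_zero (I := I) ?_
  rw [plucker_sum_smul]
  refine mul_ne_zero ?_ hI
  exact (Matrix.isUnit_nonsing_inv_det _ hMt).ne_zero

theorem pluckerNorm_le {n d : ℕ} {b : Fin d → E n} {M : ℝ} (hM : 0 ≤ M)
    (h : ∀ i k, |b i k| ≤ M) :
    pluckerNorm b ≤ Fintype.card (PluckerIndex n d) * (d.factorial * M ^ d) := by
  refine sqrt_sum_sq_le (by positivity) fun I => ?_
  have := Matrix.det_le (A := Matrix.of fun i k : Fin d => b k (I.1.orderEmbOfFin I.2 i))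
    (abv := AbsoluteValue.abs) (x := M) fun i j => h _ _
  simpa [plucker] using this

/-- Rational approximation of a subspace of dimension `d`, by Dirichlet's theorem. -/
theorem exists_rational_approx {n d : ℕ} (hd : 1 ≤ d) {A : Submodule ℝ (E n)}
    (hA : Module.finrank ℝ A = d) : ∃ C : ℝ, 1 ≤ C ∧ ∀ Q : ℕ, 1 ≤ Q → ∃ q : ℕ, 1 ≤ q ∧
      q ≤ Q ^ (d * (n - d)) ∧ ∃ B ∈ rationalSubspaces n d,
        height d B ≤ C * (q : ℝ) ^ d ∧ psi d A B ≤ C / (q * Q) := by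
  obtain ⟨I, a, haA, hdelta⟩ := exists_echelon_basis hA
  set σ := I.1.orderEmbOfFin I.2 with hσ
  have hσI : ∀ m ∈ I.1, ∃ k, σ k = m := fun m hm => by
    have : m ∈ Set.range (I.1.orderEmbOfFin I.2) := by rwa [Finset.range_orderEmbOfFin]
    exact this
  set K : ℝ := (∑ i, ‖a i‖) + 1 with hK
  have hK1 : 1 ≤ K := le_add_of_nonneg_left (Finset.sum_nonneg fun _ _ => norm_nonneg _)
  set C₁ : ℝ := Fintype.card (PluckerIndex n d) * (d.factorial * K ^ d) with hC₁
  have hC₁0 : 0 ≤ C₁ := by positivity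
  refine ⟨C₁ + d * n + 1, le_add_of_nonneg_left (by positivity), fun Q hQ => ?_⟩
  have hQ0 : (0 : ℝ) < Q := by exact_mod_cast hQ
  obtain ⟨q, hq1, hqQ, p, hp⟩ := exists_simultaneous_approx
    (fun j : Fin d × {m // m ∉ I.1} => a j.1 j.2) hQ
  have hq0 : (0 : ℝ) < q := by exact_mod_cast hq1
  have hcard : Fintype.card (Fin d × {m // m ∉ I.1}) = d * (n - d) := by
    rw [Fintype.card_prod, Fintype.card_fin, Fintype.card_subtype_compl, Fintype.card_fin]
    simp [I.2]
  rw [hcard] at hqQ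
  -- Pivot columns carry `q` times the identity, approximated without error; the others carry the
  -- Dirichlet numerators. The pivot minor is `q ^ d`, which gives independence.
  set x : Fin d → Fin n → ℤ := fun i m =>
    if h : m ∈ I.1 then (if σ i = m then (q : ℤ) else 0) else p (i, ⟨m, h⟩) with hx
  have hxσ : ∀ i k, x i (σ k) = if i = k then (q : ℤ) else 0 := fun i k => by
    have : σ k ∈ I.1 := Finset.orderEmbOfFin_mem I.1 I.2 k
    simp [hx, this]
  have happ : ∀ i m, |q * a i m - x i m| ≤ 1 / Q := fun i m => by
    by_cases h : m ∈ I.1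
    · obtain ⟨k, rfl⟩ := hσI m h
      rw [hdelta, hxσ]
      split_ifs <;> simp
    · have := hp (i, ⟨m, h⟩)
      simpa [hx, h] using this
  have hminor : minor x I = (q : ℤ) ^ d := by
    have : (Matrix.of fun i k : Fin d => x k (I.1.orderEmbOfFin I.2 i)) =
        Matrix.diagonal fun _ => (q : ℤ) := by
      ext i k
      rw [Matrix.of_apply, ← hσ, hxσ, Matrix.diagonal_apply]
      simp only [eq_comm]
    rw [minor, this, Matrix.det_diagonal]
    simp
  have hxli : LinearIndependent ℝ fun i => castE (x i) :=
    linearIndependent_castE (I := I) (by rw [hminor]; positivity)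
  have hBrat := mem_rationalSubspaces_of_castE hxli
  refine ⟨q, hq1, hqQ, _, hBrat, ?_, ?_⟩
  · have hbound : ∀ i k, |castE (x i) k| ≤ K * q := fun i k => by
      have h1 : |a i k| ≤ ∑ i, ‖a i‖ := (PiLp.norm_apply_le (a i) k).trans
        (Finset.single_le_sum (f := fun i => ‖a i‖) (fun _ _ => norm_nonneg _)
          (Finset.mem_univ i))
      have h2 : (1 : ℝ) / Q ≤ 1 := by
        rw [div_le_one hQ0]; exact_mod_cast hQ
      have h3 : (1 : ℝ) ≤ q := by exact_mod_cast hq1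
      have h4 : |(x i k : ℝ)| ≤ |q * a i k| + |q * a i k - x i k| := by
        have := abs_sub (q * a i k) (q * a i k - x i k)
        rwa [sub_sub_cancel] at this
      rw [castE_apply]
      rw [abs_mul, abs_of_pos hq0] at h4
      have h5 := happ i k
      nlinarith [mul_le_mul_of_nonneg_left h1 hq0.le]
    refine (height_le_pluckerNorm hxli).trans ((pluckerNorm_le (by positivity) hbound).trans ?_)
    rw [mul_pow, ← mul_assoc (d.factorial : ℝ), ← mul_assoc, ← hC₁]
    gcongr
    have : (0 : ℝ) ≤ d * n := by positivity
    linarith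
  · refine psi_le_of_forall_exists hd hA (finrank_of_mem_rationalSubspaces hBrat)
      fun y hy hy1 => ?_
    rw [← haA] at hy
    obtain ⟨c, rfl⟩ := (Submodule.mem_span_range_iff_exists_fun ℝ).1 hy
    -- In an echelon basis the coefficients are the pivot coordinates of the unit vector.
    have hc : ∀ k, |c k| ≤ 1 := fun k => by
      have h1 := PiLp.norm_apply_le (∑ i, c i • a i) (σ k)
      rw [hy1] at h1
      simpa [hdelta] using h1
    refine ⟨∑ i, c i • (q : ℝ)⁻¹ • castE (x i), Submodule.sum_mem _ fun i _ =>
      Submodule.smul_mem _ _ (Submodule.smul_mem _ _ (Submodule.subset_span ⟨i, rfl⟩)), ?_⟩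
    have hterm : ∀ i, ‖a i - (q : ℝ)⁻¹ • castE (x i)‖ ≤ n * (1 / (q * Q)) := fun i => by
      refine norm_le_card_mul (by positivity) fun k => ?_
      have h1 : (a i - (q : ℝ)⁻¹ • castE (x i)) k = (q : ℝ)⁻¹ * (q * a i k - x i k) := by
        simp
        field_simp
      rw [h1, abs_mul, abs_of_pos (inv_pos.2 hq0), inv_mul_le_iff₀ hq0]
      refine (happ i k).trans_eq ?_
      field_simp
    rw [← Finset.sum_sub_distrib]
    calc _ ≤ ∑ i, ‖c i • a i - c i • (q : ℝ)⁻¹ • castE (x i)‖ := norm_sum_le _ _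
      _ ≤ ∑ _i : Fin d, 1 * (n * (1 / (q * Q) : ℝ)) := Finset.sum_le_sum fun i _ => by
          rw [← smul_sub, norm_smul]
          exact mul_le_mul (hc i) (hterm i) (norm_nonneg _) zero_le_one
      _ = d * n / (q * Q) := by
          rw [Finset.sum_const, Finset.card_univ, Fintype.card_fin, nsmul_eq_mul]; ring
      _ ≤ _ := by
          gcongr
          linarith

/-- If the set were finite, `psi` would have a positive lower bound on it, as `A` is not rational.
For large `Q` the Dirichlet subspace belongs to the set, yet has `psi` at most `C / Q`, below that
bound. -/
theorem infinite_setOf_psi_le {n d : ℕ} (hd : 1 ≤ d) {A : Submodule ℝ (E n)}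
    (hA : A ∈ irrationalSubspaces n d d d) {β : ℝ} (hβ1 : 1 ≤ d * β)
    (hβ : ((d * (n - d) : ℕ) : ℝ) * (d * β - 1) < 1) :
    {B | B ∈ rationalSubspaces n d ∧ psi d A B ≤ 1 / height d B ^ β}.Infinite := by
  intro hfin
  have hβ0 : 0 ≤ β := by
    by_contra! h
    have : (d : ℝ) * β ≤ 0 := mul_nonpos_of_nonneg_of_nonpos (Nat.cast_nonneg d) h.le
    linarith
  obtain ⟨C, hC1, hC⟩ := exists_rational_approx hd hA.1
  have hC0 : 0 < C := zero_lt_one.trans_le hC1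
  set N : ℕ := d * (n - d) with hN
  -- From `q ≤ Q ^ N`, `q ^ (d * β)` is at most `q * Q ^ (1 - η)`; the spare factor `Q ^ η` absorbs
  -- the constants.
  set η : ℝ := 1 - N * (d * β - 1) with hη
  have hη0 : 0 < η := by rw [hη]; linarith
  have hpos : ∀ B ∈ {B | B ∈ rationalSubspaces n d ∧ psi d A B ≤ 1 / height d B ^ β},
      ∀ᶠ Q : ℕ in atTop, C / (Q : ℝ) < psi d A B := fun B hB => by
    refine (tendsto_const_div_atTop_nhds_zero_nat C).eventually_lt_const ?_
    refine psi_pos hA.1 (finrank_of_mem_rationalSubspaces hB.1) ?_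
    rintro rfl
    have := hA.2 A hB.1
    rw [inf_idem, hA.1] at this
    exact lt_irrefl _ this
  have hbig : ∀ᶠ Q : ℕ in atTop, C * C ^ β ≤ (Q : ℝ) ^ η :=
    ((tendsto_rpow_atTop hη0).comp tendsto_natCast_atTop_atTop).eventually_ge_atTop _
  obtain ⟨Q, hQ1, hQ2, hQ3⟩ :=
    (((eventually_all_finite hfin).2 hpos).and (hbig.and (eventually_ge_atTop 1))).exists
  obtain ⟨q, hq1, hqQ, B, hB, hBh, hBpsi⟩ := hC Q hQ3
  have hq0 : (0 : ℝ) < q := by exact_mod_cast hq1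
  have hQ0 : (0 : ℝ) < Q := by exact_mod_cast hQ3
  have hH := zero_lt_one.trans_le (one_le_height hB)
  have hHβ : height d B ^ β ≤ C ^ β * (q * (Q : ℝ) ^ (1 - η)) := calc
    height d B ^ β ≤ (C * (q : ℝ) ^ d) ^ β := Real.rpow_le_rpow hH.le hBh hβ0
    _ = C ^ β * (q : ℝ) ^ (1 + (d * β - 1)) := by
        rw [Real.mul_rpow hC0.le (by positivity), ← Real.rpow_natCast, ← Real.rpow_mul hq0.le]
        congr 2
        ring
    _ = C ^ β * (q * (q : ℝ) ^ (d * β - 1)) := by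
        rw [Real.rpow_add hq0, Real.rpow_one]
    _ ≤ C ^ β * (q * ((Q : ℝ) ^ N) ^ (d * β - 1)) := by
        have h1 : (q : ℝ) ≤ (Q : ℝ) ^ N := by exact_mod_cast hqQ
        have h2 := Real.rpow_le_rpow hq0.le h1 (sub_nonneg.2 hβ1)
        gcongr
    _ = C ^ β * (q * (Q : ℝ) ^ (1 - η)) := by
        rw [← Real.rpow_natCast, ← Real.rpow_mul hQ0.le, hη, sub_sub_cancel]
  have hmem : psi d A B ≤ 1 / height d B ^ β := by
    refine hBpsi.trans ?_
    rw [div_le_div_iff₀ (by positivity) (Real.rpow_pos_of_pos hH _), one_mul]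
    calc C * height d B ^ β ≤ C * (C ^ β * (q * (Q : ℝ) ^ (1 - η))) := by gcongr
      _ = (C * C ^ β) * (q * (Q : ℝ) ^ (1 - η)) := by ring
      _ ≤ (Q : ℝ) ^ η * (q * (Q : ℝ) ^ (1 - η)) := by gcongr
      _ = q * (Q : ℝ) ^ (η + (1 - η)) := by rw [Real.rpow_add hQ0]; ring
      _ = q * Q := by rw [add_sub_cancel, Real.rpow_one]
  have hlt := hQ1 B ⟨hB, hmem⟩
  have h3 : C / (q * Q) ≤ C / (Q : ℝ) := by
    have : (1 : ℝ) ≤ q := by exact_mod_cast hq1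
    gcongr
    nlinarith
  linarith

theorem le_exponent {n d : ℕ} (hd : 1 ≤ d) (hn : d < n) :
    ENNReal.ofReal (1 / d * (1 + 1 / (d * (n - d)))) ≤ exponent n d d d := by
  have hd0 : (0 : ℝ) < d := by exact_mod_cast hd
  have hnd : (0 : ℝ) < (n : ℝ) - d := sub_pos.2 (by exact_mod_cast hn)
  refine le_iInf₂ fun A hA => le_of_forall_lt fun c hc => ?_
  obtain ⟨γ, hγc, hγ⟩ := exists_between hc
  have hγtop : γ ≠ ⊤ := (hγ.trans ENNReal.ofReal_lt_top).ne
  refine hγc.trans_le ?_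
  -- The maximum secures `1 ≤ d * β` without leaving the admissible range.
  set β : ℝ := max γ.toReal (1 / d) with hβ
  have hγβ : γ ≤ ENNReal.ofReal β := by
    rw [← ENNReal.ofReal_toReal hγtop]
    exact ENNReal.ofReal_le_ofReal (le_max_left _ _)
  have hpos : (0 : ℝ) < 1 / (d * (n - d)) := by positivity
  have hβlt : β < 1 / d * (1 + 1 / (d * (n - d))) := by
    refine max_lt ((ENNReal.lt_ofReal_iff_toReal_lt hγtop).1 hγ) ?_
    have : (0 : ℝ) < 1 / d := by positivity
    nlinarith
  have hβd : (1 : ℝ) / d ≤ β := le_max_right _ _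
  refine hγβ.trans (le_sSup ⟨β, lt_of_lt_of_le (by positivity) hβd, rfl,
    infinite_setOf_psi_le hd hA ?_ ?_⟩)
  · rwa [div_le_iff₀' hd0] at hβd
  · have h1 : d * β < 1 + 1 / (d * (n - d)) := by
      have := mul_lt_mul_of_pos_left hβlt hd0
      rwa [← mul_assoc, mul_one_div_cancel hd0.ne', one_mul] at this
    rw [Nat.cast_mul, Nat.cast_sub hn.le]
    have h2 : (0 : ℝ) < d * (n - d) := by positivity
    calc (d : ℝ) * (n - d) * (d * β - 1) < d * (n - d) * (1 / (d * (n - d))) := by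
          gcongr; linarith
      _ = 1 := mul_one_div_cancel h2.ne'

/-! ### Upper bound: Borel–Cantelli in an affine chart -/

/-- The index set of the coordinates of the affine chart of the Grassmannian. -/
abbrev ChartIndex (n d : ℕ) : Type := Fin d × {k : Fin n // ¬ (k : ℕ) < d}

theorem card_chartIndex {n d : ℕ} (h : d ≤ n) : Fintype.card (ChartIndex n d) = d * (n - d) := by
  rw [Fintype.card_prod, Fintype.card_fin, Fintype.card_subtype_compl, Fintype.card_fin,
    Fintype.card_subtype]
  have : (Finset.univ.filter fun k : Fin n => (k : ℕ) < d).card = d := by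
    rw [Fin.card_filter_val_lt, min_eq_right h]
  rw [this]

/-- The `i`-th row of the block matrix `(I | M)`. -/
noncomputable def chartVec {n d : ℕ} (M : ChartIndex n d → ℝ) (i : Fin d) : E n :=
  WithLp.toLp 2 fun k => if h : (k : ℕ) < d then (if (k : ℕ) = i then 1 else 0) else M (i, ⟨k, h⟩)

/-- The subspace spanned by the rows of the block matrix `(I | M)`. -/
noncomputable def chart {n d : ℕ} (M : ChartIndex n d → ℝ) : Submodule ℝ (E n) :=
  Submodule.span ℝ (Set.range (chartVec M))

theorem chartVec_castLE {n d : ℕ} (h : d ≤ n) (M : ChartIndex n d → ℝ) (i k : Fin d) :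
    chartVec M i (Fin.castLE h k) = if k = i then 1 else 0 := by
  simp [chartVec, Fin.ext_iff]

theorem chartVec_apply {n d : ℕ} (M : ChartIndex n d → ℝ) (j : ChartIndex n d) :
    chartVec M j.1 j.2 = M j := by
  simp [chartVec, j.2.2]

theorem finrank_chart {n d : ℕ} (h : d ≤ n) (M : ChartIndex n d → ℝ) :
    Module.finrank ℝ (chart M) = d := by
  have hli : LinearIndependent ℝ (chartVec M) := by
    rw [Fintype.linearIndependent_iff]
    intro g hg i
    have := congrArg (fun v : E n => v (Fin.castLE h i)) hg
    simpa [chartVec_castLE] using this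
  rw [chart, finrank_span_eq_card hli, Fintype.card_fin]

theorem norm_chartVec_le {n d : ℕ} {M : ChartIndex n d → ℝ} (hM : M ∈ Set.Icc 0 1) (i : Fin d) :
    ‖chartVec M i‖ ≤ n := by
  have := norm_le_card_mul (v := chartVec M i) zero_le_one fun k => by
    simp only [chartVec]
    split_ifs with h1 h2
    · simp
    · simp
    · rw [abs_of_nonneg (hM.1 _)]
      exact hM.2 _
  rwa [mul_one] at this

/-- Move row `i` of `(I | M₁)` to a near point of `B`, then to a near point of the row space of `(I
| M₂)`. The identity block forces the coefficients of that point to be close to those of row `i`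
alone, so the remaining entries agree up to `O(ε)`. -/
theorem abs_sub_le_of_psi_chart_le {n d : ℕ} (h : d ≤ n) {M₁ M₂ : ChartIndex n d → ℝ}
    (h₁ : M₁ ∈ Set.Icc 0 1) (h₂ : M₂ ∈ Set.Icc 0 1) {B : Submodule ℝ (E n)}
    (hB : Module.finrank ℝ B = d) {ε : ℝ} (hε0 : 0 ≤ ε) (hε1 : ε ≤ 1)
    (hB₁ : psi d (chart M₁) B ≤ ε) (hB₂ : psi d (chart M₂) B ≤ ε) (j : ChartIndex n d) :
    |M₁ j - M₂ j| ≤ (d + 1) * (d * n * (d + 2)) * ε := by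
  obtain ⟨i, m⟩ := j
  have hn0 : (0 : ℝ) ≤ n := Nat.cast_nonneg n
  have hd0 : (0 : ℝ) ≤ d := Nat.cast_nonneg d
  set a := chartVec M₁ i with ha
  have han : ‖a‖ ≤ n := norm_chartVec_le h₁ i
  obtain ⟨b, hb, hab⟩ := exists_norm_sub_le_psi (finrank_chart h M₁) hB (x := a)
    (Submodule.subset_span ⟨i, rfl⟩)
  have hab' : ‖a - b‖ ≤ d * n * ε := hab.trans (by
    have := psi_nonneg d (chart M₁) B
    gcongr)
  have hbn : ‖b‖ ≤ n + d * n := by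
    have h3 : ‖b‖ ≤ ‖a‖ + ‖a - b‖ := by
      have := norm_sub_le a (a - b)
      rwa [sub_sub_cancel] at this
    have h4 : d * n * ε ≤ d * n * 1 := by gcongr
    linarith
  rw [psi_comm] at hB₂
  obtain ⟨a', ha', hba⟩ := exists_norm_sub_le_psi hB (finrank_chart h M₂) hb
  have hba' : ‖b - a'‖ ≤ d * (n + d * n) * ε := hba.trans (by
    have := psi_nonneg d B (chart M₂)
    gcongr)
  set K : ℝ := d * n * (d + 2) with hK
  have haa : ‖a - a'‖ ≤ K * ε := by
    have := norm_sub_le_norm_sub_add_norm_sub a b a'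
    calc ‖a - a'‖ ≤ d * n * ε + d * (n + d * n) * ε := by linarith
      _ = K * ε := by rw [hK]; ring
  have hcoord : ∀ k, |a k - a' k| ≤ K * ε := fun k =>
    (PiLp.norm_apply_le (a - a') k).trans haa
  obtain ⟨c, rfl⟩ := (Submodule.mem_span_range_iff_exists_fun ℝ).1 ha'
  have hc : ∀ k, |(if k = i then 1 else 0) - c k| ≤ K * ε := fun k => by
    have := hcoord (Fin.castLE h k)
    rw [ha, chartVec_castLE] at this
    simpa [chartVec_castLE] using this
  have hm := hcoord m
  have hsum : |∑ k, ((if k = i then 1 else 0) - c k) * M₂ (k, m)| ≤ d * (K * ε) := by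
    refine (Finset.abs_sum_le_sum_abs _ _).trans ?_
    calc _ ≤ ∑ _k : Fin d, K * ε := Finset.sum_le_sum fun k _ => by
          rw [abs_mul, abs_of_nonneg (h₂.1 _)]
          calc _ ≤ |(if k = i then 1 else 0) - c k| * 1 := by
                gcongr
                exact h₂.2 _
            _ ≤ _ := by rw [mul_one]; exact hc k
      _ = _ := by simp
  have h5 : (∑ k, c k • chartVec M₂ k) m = ∑ k, c k * M₂ (k, m) := by
    simp only [PiLp.smul_apply, WithLp.ofLp_sum, Finset.sum_apply, smul_eq_mul]
    exact Finset.sum_congr rfl fun k _ => by rw [← chartVec_apply M₂ (k, m)]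
  have h6 : ∑ k, ((if k = i then 1 else 0) - c k) * M₂ (k, m) =
      M₂ (i, m) - ∑ k, c k * M₂ (k, m) := by
    simp [sub_mul, Finset.sum_sub_distrib]
  rw [h5, ha, chartVec_apply M₁ (i, m)] at hm
  rw [h6] at hsum
  have h7 : M₁ (i, m) - M₂ (i, m) = (M₁ (i, m) - ∑ k, c k * M₂ (k, m)) -
      (M₂ (i, m) - ∑ k, c k * M₂ (k, m)) := by ring
  rw [h7]
  refine (abs_sub _ _).trans ?_
  calc _ ≤ K * ε + d * (K * ε) := add_le_add hm hsum
    _ = _ := by ring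

theorem psi_self {n d : ℕ} (hd : 1 ≤ d) {A : Submodule ℝ (E n)} (hA : Module.finrank ℝ A = d) :
    psi d A A ≤ 0 :=
  psi_le_of_forall_exists hd hA hA fun x hx _ => ⟨x, hx, by simp⟩

/-- The set has diameter `O(ε)` in the sup metric, and volume is at most the diameter to the power
of the dimension. -/
theorem volume_setOf_psi_chart_le {n d : ℕ} (h : d ≤ n) {B : Submodule ℝ (E n)}
    (hB : Module.finrank ℝ B = d) {ε : ℝ} (hε0 : 0 ≤ ε) (hε1 : ε ≤ 1) :
    MeasureTheory.volume {M : ChartIndex n d → ℝ | M ∈ Set.Icc 0 1 ∧ psi d (chart M) B ≤ ε} ≤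
      ENNReal.ofReal (((d + 1) * (d * n * (d + 2)) * ε) ^ (d * (n - d))) := by
  refine (Real.volume_pi_le_diam_pow _).trans ?_
  rw [card_chartIndex h, ENNReal.ofReal_pow (by positivity)]
  gcongr
  refine Metric.ediam_le fun M₁ h₁ M₂ h₂ => ?_
  rw [edist_dist]
  refine ENNReal.ofReal_le_ofReal ((dist_pi_le_iff (by positivity)).2 fun j => ?_)
  exact abs_sub_le_of_psi_chart_le h h₁.1 h₂.1 hB hε0 hε1 h₁.2 h₂.2 j

theorem exists_chart_of_lt {n d : ℕ} (hd : 1 ≤ d) (hn : d < n) {β : ℝ} (hβ0 : 0 < β)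
    (hβ : (n : ℝ) < β * (d * (n - d) : ℕ)) : ∃ M : ChartIndex n d → ℝ,
      chart M ∉ rationalSubspaces n d ∧
      {B | B ∈ rationalSubspaces n d ∧ psi d (chart M) B ≤ 1 / height d B ^ β}.Finite := by
  have := (countable_rationalSubspaces n d).to_subtype
  -- A point has measure zero only in positive dimension.
  have hne : Nonempty (ChartIndex n d) := ⟨(⟨0, hd⟩, ⟨⟨d, hn⟩, lt_irrefl d⟩)⟩
  set N := d * (n - d) with hN
  set C : ℝ := (d + 1) * (d * n * (d + 2)) with hC
  set S : rationalSubspaces n d → Set (ChartIndex n d → ℝ) := fun B =>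
    {M | M ∈ Set.Icc 0 1 ∧ psi d (chart M) B.1 ≤ 1 / height d B.1 ^ β} with hS
  have hvol : ∀ B, MeasureTheory.volume (S B) ≤
      ENNReal.ofReal (C ^ N * height d B.1 ^ (-(β * N))) := fun B => by
    have hH := one_le_height B.2
    have hH0 := zero_lt_one.trans_le hH
    refine (volume_setOf_psi_chart_le hn.le (finrank_of_mem_rationalSubspaces B.2)
      (by positivity) ?_).trans_eq ?_
    · rw [div_le_one (by positivity)]
      exact Real.one_le_rpow hH hβ0.le
    · rw [← hC, ← hN, mul_pow, one_div, ← Real.rpow_neg hH0.le, ← Real.rpow_natCast (_ ^ (-β)),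
        ← Real.rpow_mul hH0.le, neg_mul]
  have hlim : MeasureTheory.volume (limsup S cofinite) = 0 := by
    refine MeasureTheory.measure_limsup_cofinite_eq_zero (ne_top_of_le_ne_top ?_
      (ENNReal.tsum_le_tsum hvol))
    exact ((summable_height_rpow hd hβ).mul_left _).tsum_ofReal_ne_top
  -- Parameters of rational subspaces: each `B` has at most one in the cube, by the comparison above
  -- with `ε = 0`, so this countable union is null.
  set R : Set (ChartIndex n d → ℝ) :=
    ⋃ B : rationalSubspaces n d, {M | M ∈ Set.Icc 0 1 ∧ chart M = B.1} with hR
  have hR0 : MeasureTheory.volume R = 0 := by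
    refine MeasureTheory.measure_iUnion_null fun B => Set.Subsingleton.measure_zero ?_ _
    rintro M₁ ⟨h₁, h₁'⟩ M₂ ⟨h₂, h₂'⟩
    have hfr := finrank_of_mem_rationalSubspaces B.2
    ext j
    have := abs_sub_le_of_psi_chart_le hn.le h₁ h₂ hfr le_rfl zero_le_one
      (by rw [h₁']; exact psi_self hd hfr) (by rw [h₂']; exact psi_self hd hfr) j
    rw [mul_zero] at this
    exact sub_eq_zero.1 (abs_nonpos_iff.1 this)
  have hcube : MeasureTheory.volume (Set.Icc (0 : ChartIndex n d → ℝ) 1) = 1 := by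
    rw [Real.volume_Icc_pi]
    simp
  obtain ⟨M, hM, hMn⟩ : ∃ M ∈ Set.Icc (0 : ChartIndex n d → ℝ) 1,
      M ∉ limsup S cofinite ∪ R := by
    by_contra! hcon
    have h1 := MeasureTheory.measure_mono (μ := MeasureTheory.volume) hcon
    rw [hcube, MeasureTheory.measure_union_null hlim hR0] at h1
    exact absurd h1 (by simp)
  rw [Set.mem_union, not_or] at hMn
  refine ⟨M, fun hrat => hMn.2 (Set.mem_iUnion.2 ⟨⟨_, hrat⟩, hM, rfl⟩), ?_⟩
  have hfin : {B : rationalSubspaces n d | M ∈ S B}.Finite := by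
    by_contra hinf
    exact hMn.1 (mem_limsup_iff_frequently_mem.2 (frequently_cofinite_iff_infinite.2 hinf))
  refine (hfin.image Subtype.val).subset ?_
  rintro B ⟨hB, hpsi⟩
  exact ⟨⟨B, hB⟩, ⟨hM, hpsi⟩, rfl⟩

/-- Heights are at least 1, so the solution sets shrink as the exponent grows. -/
theorem exponentOf_le_of_finite {n d : ℕ} {A : Submodule ℝ (E n)} {β : ℝ}
    (h : {B | B ∈ rationalSubspaces n d ∧ psi d A B ≤ 1 / height d B ^ β}.Finite) :
    exponentOf A d d ≤ ENNReal.ofReal β := by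
  refine sSup_le ?_
  rintro _ ⟨γ, -, rfl, hinf⟩
  refine ENNReal.ofReal_le_ofReal ?_
  by_contra! hlt
  refine hinf (h.subset ?_)
  rintro B ⟨hB, hpsi⟩
  have hH := one_le_height hB
  have hH0 := zero_lt_one.trans_le hH
  refine ⟨hB, hpsi.trans ?_⟩
  gcongr

/-- In equal dimension `d`, an intersection of dimension at least `d` forces `A = B`. -/
theorem mem_irrationalSubspaces {n d : ℕ} {A : Submodule ℝ (E n)} (hA : Module.finrank ℝ A = d)
    (h : A ∉ rationalSubspaces n d) : A ∈ irrationalSubspaces n d d d := by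
  refine ⟨hA, fun B hB => ?_⟩
  by_contra! hle
  have h1 : A ⊓ B = A := Submodule.eq_of_le_of_finrank_le inf_le_left (hA.trans_le hle)
  have h2 : A = B := Submodule.eq_of_le_of_finrank_eq (inf_eq_left.1 h1)
    (hA.trans (finrank_of_mem_rationalSubspaces hB).symm)
  exact h (h2 ▸ hB)

theorem exponent_le {n d : ℕ} (hd : 1 ≤ d) (hn : d < n) :
    exponent n d d d ≤ ENNReal.ofReal (n / (d * (n - d))) := by
  have hd0 : (0 : ℝ) < d := by exact_mod_cast hd
  have hnd : (0 : ℝ) < (n : ℝ) - d := sub_pos.2 (by exact_mod_cast hn)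
  have hn0 : (0 : ℝ) < n := by linarith
  refine le_of_forall_gt_imp_ge_of_dense fun c hc => ?_
  rcases eq_or_ne c ⊤ with rfl | hctop
  · exact le_top
  have hβ : n / (d * (n - d)) < c.toReal :=
    (ENNReal.ofReal_lt_iff_lt_toReal (by positivity) hctop).1 hc
  have hβ0 : 0 < c.toReal := lt_of_le_of_lt (by positivity) hβ
  obtain ⟨M, hM, hfin⟩ := exists_chart_of_lt hd hn hβ0 (by
    rw [Nat.cast_mul, Nat.cast_sub hn.le]
    rwa [div_lt_iff₀ (by positivity)] at hβ)
  rw [← ENNReal.ofReal_toReal hctop]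
  exact (iInf₂_le _ (mem_irrationalSubspaces (finrank_chart hn.le M) hM)).trans
    (exponentOf_le_of_finite hfin)

/-! ### The limit and the final comparison -/

theorem tendsto_div_mul_sub {d : ℕ} (hd : 1 ≤ d) :
    Tendsto (fun n : ℕ => (n : ℝ) / (d * (n - d))) atTop (𝓝 (1 / d)) := by
  have hd0 : (d : ℝ) ≠ 0 := by exact_mod_cast (by omega : d ≠ 0)
  have h1 : Tendsto (fun n : ℕ => 1 / ((d : ℝ) * (1 - d / n))) atTop (𝓝 (1 / (d * (1 - 0)))) :=
    tendsto_const_nhds.div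
      (((tendsto_const_div_atTop_nhds_zero_nat (d : ℝ)).const_sub 1).const_mul (d : ℝ))
      (by simpa using hd0)
  rw [sub_zero, mul_one] at h1
  refine h1.congr' ?_
  filter_upwards [eventually_gt_atTop d] with n hn
  have hnd : (n : ℝ) - d ≠ 0 := (sub_pos.2 (by exact_mod_cast hn)).ne'
  have hn0 : (n : ℝ) ≠ 0 := by exact_mod_cast (by omega : n ≠ 0)
  field_simp

end SubspaceApprox

theorem mainTheorem6 (d : ℕ) (hd : 1 ≤ d) :
    (∀ n : ℕ, 2 * d ≤ n →
      ENNReal.ofReal ((2 * (d : ℝ) * n - (d : ℝ) ^ 2 + d + 2) /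
          (2 * (d : ℝ) ^ 2 * n - (d : ℝ) ^ 3 + (d : ℝ) ^ 2)) ≤
        SubspaceApprox.exponent n d d d ∧
      SubspaceApprox.exponent n d d d ≤
        ENNReal.ofReal ((n : ℝ) / ((d : ℝ) * ((n : ℝ) - d)))) ∧
    Tendsto (fun n : ℕ => SubspaceApprox.exponent n d d d) atTop
      (𝓝 (ENNReal.ofReal (1 / (d : ℝ)))) := by
  have hd0 : (0 : ℝ) < d := by exact_mod_cast hd
  refine ⟨fun n hn => ⟨?_, SubspaceApprox.exponent_le hd (by omega)⟩, ?_⟩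
  · refine (ENNReal.ofReal_le_ofReal ?_).trans (SubspaceApprox.le_exponent hd (by omega))
    have hnd : (0 : ℝ) < (n : ℝ) - d := sub_pos.2 (by exact_mod_cast (by omega : d < n))
    have h1 : (0 : ℝ) < 2 * n - d + 1 := by linarith
    -- In this form the stated bound follows from the Dirichlet bound `1 / d * (1 + 1 / (d * (n -
    -- d)))`, because `2 * (n - d) ≤ 2 * n - d + 1`.
    have h2 : (2 * (d : ℝ) * n - (d : ℝ) ^ 2 + d + 2) /
        (2 * (d : ℝ) ^ 2 * n - (d : ℝ) ^ 3 + (d : ℝ) ^ 2) =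
        1 / d * (1 + 2 / (d * (2 * n - d + 1))) := by
      have h3 : 2 * (d : ℝ) ^ 2 * n - (d : ℝ) ^ 3 + (d : ℝ) ^ 2 = d ^ 2 * (2 * n - d + 1) := by
        ring
      rw [h3]
      field_simp
    rw [h2]
    gcongr 1 / (d : ℝ) * (1 + ?_)
    rw [div_le_div_iff₀ (by positivity) (by positivity)]
    nlinarith
  · refine tendsto_of_tendsto_of_tendsto_of_le_of_le' tendsto_const_nhds
      ((ENNReal.continuous_ofReal.tendsto _).comp (SubspaceApprox.tendsto_div_mul_sub hd)) ?_ ?_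
    · filter_upwards [eventually_gt_atTop d] with n hn
      refine (ENNReal.ofReal_le_ofReal ?_).trans (SubspaceApprox.le_exponent hd hn)
      have hnd : (0 : ℝ) < (n : ℝ) - d := sub_pos.2 (by exact_mod_cast hn)
      have h1 : (0 : ℝ) ≤ 1 / (d * (n - d)) := by positivity
      exact le_mul_of_one_le_right (by positivity) (by linarith)
    · filter_upwards [eventually_gt_atTop d] with n hn
      exact SubspaceApprox.exponent_le hd hn
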